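/- Setting. $K\ge 1$ active users share one codebook with $M\ge K$ messages and blocklength $n\ge1$; the delay constraint is $D_{\mathrm m}=\alpha n\in\mathbb Z_{\ge0}$ with $\alpha\in[0,1)$. A delay vector is $D=(d_1,\dots,d_K)\in\mathbb Z_{\ge 0}^K$ with $0=d_1\le d_2\le\dots\le d_K\le\alpha n$. An encoder is a map $f:\{1,\dots,M\}\to\{x\in\mathbb R^n:\|x\|^2\le nP'\}$. The messages $M_1,\dots,M_K$ are independent and uniform on $\{1,\dots,M\}$, and with $f(M_i)=X_i$ the receiver observes, for $1\le\ell\le n$, $Y_\ell=\sum_{i=1}^K X_{i,\ell-d_i}+Z_\ell$, where $X_{i,j}:=0$ for $j\le 0$ and the $Z_\ell$ are i.i.d. $\mathcal N(0,1)$. For $S\subseteq\{1,\dots,K\}$ let $a_\ell(S,D)=|\{i\in S: d_i<\ell\}|$ and $a^n(S,D)=[a_1(S,D),\dots,a_n(S,D)]$. The receiver knows $D$ and outputs the set of the $K$ messages of a tuple of distinct messages $(m_1,\dots,m_K)$ that maximizes the information density $\sum_{\ell=1}^n\log\frac{dP_{Y|X_{[K]}}(Y_\ell\,|\,f(m_1)_{\ell-d_1},\dots,f(m_K)_{\ell-d_K})}{dP_{Y}(Y_\ell)}$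 over all such tuples; here $P_{Y|X_{[K]}}(\cdot|x_1,\dots,x_K)=\mathcal N(\sum_i x_i,1)$ and at time $\ell$ the reference law is $P_Y=\mathcal N(0,1+a_\ell([K],D)P)$. The per-user probability of error is $$\mathrm{P}_{\mathrm{PUPE}}=\max_{D}\frac1K\sum_{i=1}^K\Pr\big(\exists\, l\ne i:\ M_i=M_l,\ \text{or } M_i\notin g(Y^n),\ \text{or } \|f(M_i)\|^2>nP'\,\big|\,D\big),$$ the maximum being over all delay vectors $D$, and $g$ denoting the decoder. For $a\in\mathbb Z_{\ge0}^n$ and $t\in(0,1)$ let $$E(a,t)=\tfrac12\sum_{i=1}^n\Big(t\log(1+a_iP)+\log\Big(1-\frac{a_iPt^2}{1+a_iP}\Big)\Big),$$ let $E^{(1)}_t,E^{(2)}_t$ be its first and second derivatives in $t$, and let $g_1(a,t)=\exp(t\,s\log M-E(a,t))$, where $s=|S|$ is the size of the set under consideration. For $\iota\in\{0,1\}$ and $1\le s\le K$ let $a^{*}_{\iota}=a^*_{\iota}(s)=[\iota^{\alpha n},s^{\,n-\alpha n}]$ (first $\alpha n$ entries $\iota$, the others $s$). Let $p_0=\frac{K(K-1)}{2M}+\sum_{i=1}^K\Pr(\|G_i\|^2>nP')$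 with $G_i\sim\mathcal N(0,P\,I_n)$. Theorem. Fix $K\ge1$, $0<P<P'$ and $\alpha\in[0,1)$. There is a constant $C$, depending only on $K,P,P',\alpha$, such that the following holds for all $n\ge1$ with $\alpha n\in\mathbb Z$ and all $M\ge K$. Suppose that for each nonempty $S\subseteq\{1,\dots,K\}$, with $s=|S|$ and $\iota=\mathbb 1(1\in S)$, there are points $t_0(a^*_\iota),\underline t_\iota,\bar t_\iota\in(0,1)$ (depending on $\iota$ and $s$) such that $$E^{(1)}_t(a^*_\iota,t_0(a^*_\iota))=s\log M,$$ $$\sum_{i=1}^n\frac{a^*_{\iota,i}P\,\bar t_\iota}{1+a^*_{\iota,i}P(1-\bar t_\iota^2)}=\frac n2\log(1+sP)-s\log M,\qquad \frac{s\,nP\,\underline t_\iota}{1+sP(1-\underline t_\iota^2)}=\sum_{i=1}^n\frac{\log(1+a^*_{\iota,i}P)}2-s\log M,$$ and such that $\underline t_\iota\le t_0(a^n)\le\bar t_\iota$ for every delay vector $D$, where $a^n=a^n(S,D)$ and $t_0(a^n)\in(0,1)$ is the saddlepoint, $E^{(1)}_t(a^n,t_0(a^n))=s\log M$. Then there exist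 an encoder and a decoder as above, the same encoder for all delay vectors, with $$\mathrm{P}_{\mathrm{PUPE}}\le\frac1{K\sqrt{2\pi}}\sum_{s=1}^{K}\left(\binom{K-1}{s}\frac{s\,g_1(a^*_0,t_0(a^*_0))}{T^*_0\sqrt{-E^{(2)}_t(a^*_0,\underline t_0)}}+\binom{K-1}{s-1}\frac{s\,g_1(a^*_1,t_0(a^*_1))}{T^*_1\sqrt{-E^{(2)}_t(a^*_1,\underline t_1)}}\right)+p_0+C\,\frac{e^{-n}}{\sqrt n},$$ where $T^*_\iota=\min\{\underline t_\iota-\underline t_\iota^2,\ \bar t_\iota-\bar t_\iota^2\}$ (the term with $\binom{K-1}{K}=0$ is absent). -/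

import Mathlib

open MeasureTheory ProbabilityTheory

namespace AUMAC

/-- Delay vectors `[d₁, …, d_K]` of nonnegative integers with `0 = d₁`, nondecreasing entries
and maximal delay at most `Dm`. Users are numbered from `0`. -/
structure DelayVector (K Dm : ℕ) where
  d : Fin K → ℕ
  first : ∀ i : Fin K, (i : ℕ) = 0 → d i = 0
  mono : Monotone d
  le_max : ∀ i, d i ≤ Dm

/-- The shift `τ_d(x, ℓ) = x_{ℓ - d}`, which is `0` before the codeword has started. -/
def shift {n : ℕ} (d : ℕ) (x : Fin n → ℝ) (ℓ : Fin n) : ℝ :=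
  if d ≤ (ℓ : ℕ) then x ⟨(ℓ : ℕ) - d, lt_of_le_of_lt (Nat.sub_le _ _) ℓ.isLt⟩ else 0

/-- The number of symbols of users in `S` that are present at channel use `ℓ`
(channel uses are numbered from `0`). -/
def overlap {K Dm : ℕ} (n : ℕ) (S : Finset (Fin K)) (D : DelayVector K Dm) (ℓ : Fin n) : ℕ :=
  (S.filter fun i => D.d i ≤ (ℓ : ℕ)).card

/-- The superposition of the shifted codewords. -/
def signal {n K Dm : ℕ} (D : DelayVector K Dm) (x : Fin K → Fin n → ℝ) (ℓ : Fin n) : ℝ :=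
  ∑ i, shift (D.d i) (x i) ℓ

/-- The received word: superposition of the shifted codewords plus noise. -/
def received {n K Dm : ℕ} (D : DelayVector K Dm) (x : Fin K → Fin n → ℝ) (z : Fin n → ℝ) :
    Fin n → ℝ :=
  fun ℓ => signal D x ℓ + z ℓ

/-- The information density accumulated over the `n` channel uses. Given the channel inputs,
`Y_ℓ` is Gaussian with unit variance around their sum; the output law `P_Y` at use `ℓ`, induced by
i.i.d. inputs of law `N(0, P)`, is `N(0, 1 + a P)` with `a` the number of symbols present at `ℓ`. -/
noncomputable def infoDensity {n K Dm : ℕ} (P : ℝ) (D : DelayVector K Dm)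
    (x : Fin K → Fin n → ℝ) (y : Fin n → ℝ) : ℝ :=
  ∑ ℓ, Real.log (gaussianPDFReal (signal D x ℓ) 1 (y ℓ) /
    gaussianPDFReal 0 (1 + (overlap n Finset.univ D ℓ : ℝ) * P).toNNReal (y ℓ))

/-- A code for the asynchronous unsourced multiple access channel with `K` active users,
`M` messages, blocklength `n`, maximal delay `Dm` and maximal power `P'`: one common encoder, and a
receiver that knows the delays and outputs the `K` messages of a tuple of distinct messages
maximizing the information density (with reference power `P`). -/
structure Code (n M K Dm : ℕ) (P P' : ℝ) where
  encode : Fin M → Fin n → ℝ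
  power : ∀ m, ∑ j, encode m j ^ 2 ≤ n * P'
  decode : DelayVector K Dm → (Fin n → ℝ) → Finset (Fin M)
  measurable_decode : ∀ D s, MeasurableSet {y | decode D y = s}
  maximal : ∀ D y, ∃ m : Fin K → Fin M, Function.Injective m ∧
    decode D y = Finset.univ.image m ∧
    ∀ m' : Fin K → Fin M, Function.Injective m' →
      infoDensity P D (fun i => encode (m' i)) y ≤ infoDensity P D (fun i => encode (m i)) y

/-- Law of the messages and the noise: independent messages, uniform on the message set, and
independent standard Gaussian noise. -/
noncomputable def law (n M K : ℕ) : Measure ((Fin K → Fin M) × (Fin n → ℝ)) :=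
  (Measure.pi fun _ : Fin K => uniformOn (Set.univ : Set (Fin M))).prod
    (Measure.pi fun _ : Fin n => gaussianReal 0 1)

/-- The error event of user `i`: its message collides with that of another user, or is not
decoded, or its codeword violates the power constraint. -/
def Code.errorEvent {n M K Dm : ℕ} {P P' : ℝ} (c : Code n M K Dm P P') (D : DelayVector K Dm)
    (i : Fin K) : Set ((Fin K → Fin M) × (Fin n → ℝ)) :=
  {ω | (∃ l, l ≠ i ∧ ω.1 i = ω.1 l) ∨
    ω.1 i ∉ c.decode D (received D (fun k => c.encode (ω.1 k)) ω.2) ∨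
    n * P' < ∑ j, c.encode (ω.1 i) j ^ 2}

/-- The per-user probability of error for given delays. -/
noncomputable def Code.pupe {n M K Dm : ℕ} {P P' : ℝ} (c : Code n M K Dm P P')
    (D : DelayVector K Dm) : ℝ :=
  (1 / (K : ℝ)) * ∑ i, (law n M K).real (c.errorEvent D i)

/-- The function `E(aⁿ, t)`. -/
noncomputable def E {n : ℕ} (P : ℝ) (a : Fin n → ℕ) (t : ℝ) : ℝ :=
  (1 / 2) * ∑ i, (t * Real.log (1 + a i * P) + Real.log (1 - a i * P * t ^ 2 / (1 + a i * P)))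

/-- `E_t^{(1)}`, the first derivative of `E` in `t`. -/
noncomputable def E₁ {n : ℕ} (P : ℝ) (a : Fin n → ℕ) (t : ℝ) : ℝ := deriv (E P a) t

/-- `E_t^{(2)}`, the second derivative of `E` in `t`. -/
noncomputable def E₂ {n : ℕ} (P : ℝ) (a : Fin n → ℕ) (t : ℝ) : ℝ := iteratedDeriv 2 (E P a) t

/-- `g₁(aⁿ, t) = exp(t s log M - E(aⁿ, t))` with `s = |S|`. -/
noncomputable def g₁ {n : ℕ} (M : ℕ) (P : ℝ) (s : ℕ) (a : Fin n → ℕ) (t : ℝ) : ℝ :=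
  Real.exp (t * s * Real.log M - E P a t)

/-- The worst-case profile `[ι^{Dm}, s^{n - Dm}]`. -/
def worst (n Dm ι s : ℕ) (i : Fin n) : ℕ := if (i : ℕ) < Dm then ι else s

/-- `ι(S) = 1` if the first user is in `S`, and `0` otherwise. -/
def iota {K : ℕ} (S : Finset (Fin K)) : ℕ := if ∃ i ∈ S, (i : ℕ) = 0 then 1 else 0

/-- `t ∈ (0,1)` is a saddlepoint of the profile `a`: `E_t^{(1)}(a, t) = s log M`. -/
def IsSaddle {n : ℕ} (M : ℕ) (P : ℝ) (s : ℕ) (a : Fin n → ℕ) (t : ℝ) : Prop :=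
  t ∈ Set.Ioo (0 : ℝ) 1 ∧ E₁ P a t = s * Real.log M

/-- The upper auxiliary point for the profile `a = a*`. -/
def IsUpper {n : ℕ} (M : ℕ) (P : ℝ) (s : ℕ) (a : Fin n → ℕ) (t : ℝ) : Prop :=
  t ∈ Set.Ioo (0 : ℝ) 1 ∧
    ∑ i, a i * P * t / (1 + a i * P * (1 - t ^ 2)) =
      (n : ℝ) / 2 * Real.log (1 + s * P) - s * Real.log M

/-- The lower auxiliary point for the profile `a = a*`. -/
def IsLower {n : ℕ} (M : ℕ) (P : ℝ) (s : ℕ) (a : Fin n → ℕ) (t : ℝ) : Prop :=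
  t ∈ Set.Ioo (0 : ℝ) 1 ∧
    s * n * P * t / (1 + s * P * (1 - t ^ 2)) =
      ∑ i, Real.log (1 + a i * P) / 2 - s * Real.log M

/-- `p₀`: the collision term plus the probability that Gaussian codewords violate the power
constraint. -/
noncomputable def p₀ (n M K : ℕ) (P P' : ℝ) : ℝ :=
  (K : ℝ) * (K - 1) / (2 * M) + ∑ _i : Fin K,
    (Measure.pi fun _ : Fin n => gaussianReal 0 P.toNNReal).real {x | n * P' < ∑ j, x j ^ 2}

/-- The term `s g₁(a*_ι, t₀) / (T*_ι √(-E_t^{(2)}(a*_ι, t̲)))`, `T*_ι = min(t̲ - t̲², t̄ - t̄²)`. -/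
noncomputable def term (n M Dm : ℕ) (P : ℝ) (ι s : ℕ) (t₀ tl tu : ℝ) : ℝ :=
  s * g₁ M P s (worst n Dm ι s) t₀ /
    (min (tl - tl ^ 2) (tu - tu ^ 2) * Real.sqrt (-E₂ P (worst n Dm ι s) tl))

/-- The explicit part of the uniform bound (without the remainder); `t₀ ι s`, `tl ι s`, `tu ι s`
are the saddlepoint and the lower and upper auxiliary points of the profile `worst n Dm ι s`. -/
noncomputable def mainBound (n M K Dm : ℕ) (P P' : ℝ) (t₀ tl tu : ℕ → ℕ → ℝ) : ℝ :=
  1 / (K * Real.sqrt (2 * Real.pi)) * ∑ s ∈ Finset.Icc 1 K,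
    (((K - 1).choose s : ℝ) * term n M Dm P 0 s (t₀ 0 s) (tl 0 s) (tu 0 s) +
      ((K - 1).choose (s - 1) : ℝ) * term n M Dm P 1 s (t₀ 1 s) (tl 1 s) (tu 1 s)) +
  p₀ n M K P P'

end AUMAC

/-! The codewords are drawn with a power `Q` strictly between `P` and `P'`, while the explicit bound
is written with `P`. The surplus power lowers the error probability exponentially, so Gallager-type
random coding with crude constants is enough, and tail probabilities need no saddlepoint expansion.

Coding side. The reference law involves the output only, so the decoder is a minimum distance
decoder (`infoDensity_eq`). A wrong candidate has a set `R` of positions with fresh messages and a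
map `π` telling whose messages it carries elsewhere; `S` is the set of users whose messages it
misses, and `|R| = |S| = s`. Given the true words and the noise, the union over the candidates of
one pattern has probability at most `min(1, M^s p) ≤ (M^s p)^t`, with `p` a Chernoff bound.
Averaging leaves Gaussian integrals in which only the overlaps of `R` and `S` occur
(`prod_union_confusion_le`). With tilt `1/(1+t)`, where `t` is the saddlepoint of the worst profile,
`prod_factor_le` bounds this by `g₁ · exp(-γ t (n - Dm))`, `γ` being the `powerGain`. Truncating to
the power ball costs a constant, since at most `2K` words of the codebook are involved. Summing over
the polynomially many delay vectors yields one codebook for all of them (`exists_codebook`).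

Comparison side. A summand of the explicit bound is at least a constant times `g₁ / (tl √n)`
(`le_term`). If every `t₀` exceeds `c₀/√n`, the gain is at most `exp(-δ√n)` and beats all polynomial
losses once `n ≥ N` (`g₁_le_mainBound`, `eventually_pow_mul_exp_le`). If some `t₀ ≤ c₀/√n`, then
`g₁` is bounded below there (`exp_le_g₁`), and `tl ≤ t₀` pushes the explicit bound above `1`
(`one_le_mainBound`). For `n < N` the remainder alone is at least `1`. In the last two cases every
code is good enough. -/

namespace AUMAC

open scoped ENNReal NNReal

/-! ### Gaussian integrals and superpositions of shifted Gaussian words. -/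

section Integrals

theorem lintegral_pi_prod {ι : Type*} [Fintype ι] (μ : ι → Measure ℝ)
    [∀ i, IsProbabilityMeasure (μ i)] (f : ι → ℝ → ℝ≥0∞) (hf : ∀ i, Measurable (f i)) :
    ∫⁻ x, ∏ i, f i (x i) ∂Measure.pi μ = ∏ i, ∫⁻ y, f i y ∂μ i := by
  have h := lintegral_prod_eq_prod_lintegral_of_indepFun Finset.univ
    (fun i (x : ι → ℝ) => f i (x i)) (μ := Measure.pi μ)
    (iIndepFun_pi (X := fun i => f i) fun i => (hf i).aemeasurable)
    (fun i => (hf i).comp (measurable_pi_apply i))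
  rw [h]
  refine Finset.prod_congr rfl fun i _ => ?_
  rw [← (measurePreserving_eval μ i).lintegral_comp (hf i)]

/-- Completing the square turns the tilted density into a constant times a Gaussian density of
variance `v / (1 + v p)`. Variance `0` is needed for channel uses at which none of the words
considered is present. -/
theorem lintegral_exp_quadratic_gaussianReal (v : ℝ≥0) (p q r : ℝ) (h : 0 < 1 + v * p) :
    ∫⁻ y, ENNReal.ofReal (Real.exp (r - (p * y ^ 2 + 2 * q * y) / 2)) ∂gaussianReal 0 v =
      ENNReal.ofReal ((√(1 + v * p))⁻¹ * Real.exp (r + v * q ^ 2 / (2 * (1 + v * p)))) := by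
  by_cases hv : v = 0
  · subst hv
    simp [gaussianReal_zero_var, lintegral_dirac]
  have hv0 : (0 : ℝ) < v := by positivity
  set w : ℝ≥0 := ⟨v / (1 + v * p), by positivity⟩ with hw
  have hwr : (w : ℝ) = v / (1 + v * p) := rfl
  have hw0 : w ≠ 0 := by
    intro h0
    have : (w : ℝ) = 0 := by simp [h0]
    rw [hwr] at this
    have : (0 : ℝ) < v / (1 + v * p) := by positivity
    linarith
  rw [gaussianReal_of_var_ne_zero _ hv, lintegral_withDensity_eq_lintegral_mul _
    (measurable_gaussianPDF _ _) (by fun_prop)]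
  have key : ∀ y, gaussianPDF 0 v y *
      ENNReal.ofReal (Real.exp (r - (p * y ^ 2 + 2 * q * y) / 2)) =
      ENNReal.ofReal ((√(1 + v * p))⁻¹ * Real.exp (r + v * q ^ 2 / (2 * (1 + v * p)))) *
        gaussianPDF (-(q * w)) w y := by
    intro y
    rw [gaussianPDF, gaussianPDF, ← ENNReal.ofReal_mul (gaussianPDFReal_nonneg _ _ _),
      ← ENNReal.ofReal_mul (by positivity)]
    congr 1
    simp only [gaussianPDFReal, hwr]
    have hs : √(2 * Real.pi * v) = √(1 + v * p) * √(2 * Real.pi * (v / (1 + v * p))) := by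
      rw [← Real.sqrt_mul h.le]
      congr 1
      field_simp
    have h1 : √(1 + v * p) ≠ 0 := (Real.sqrt_pos.2 h).ne'
    rw [hs, mul_inv]
    have he : Real.exp (-(y - 0) ^ 2 / (2 * v)) * Real.exp (r - (p * y ^ 2 + 2 * q * y) / 2) =
        Real.exp (r + v * q ^ 2 / (2 * (1 + v * p))) *
          Real.exp (-(y - -(q * (v / (1 + v * p)))) ^ 2 / (2 * (v / (1 + v * p)))) := by
      rw [← Real.exp_add, ← Real.exp_add]
      congr 1
      field_simp
      ring
    calc _ = (√(1 + v * p))⁻¹ * (√(2 * Real.pi * (v / (1 + v * p))))⁻¹ *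
        (Real.exp (-(y - 0) ^ 2 / (2 * v)) * Real.exp (r - (p * y ^ 2 + 2 * q * y) / 2)) := by ring
      _ = _ := by rw [he]; ring
  simp only [Pi.mul_apply, key]
  rw [lintegral_const_mul _ (measurable_gaussianPDF _ _)]
  simp only [gaussianPDF]
  rw [lintegral_gaussianPDFReal_eq_one _ hw0, mul_one]

theorem integral_cexp_pi_gaussianReal {ι : Type*} [Fintype ι] (v : ι → ℝ≥0) (θ : ι → ℝ) :
    ∫ x : ι → ℝ, Complex.exp ((∑ i, x i * θ i : ℝ) * Complex.I)
        ∂(Measure.pi fun i => gaussianReal 0 (v i)) =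
      Complex.exp ((-(∑ i, v i * θ i ^ 2) / 2 : ℝ)) := by
  have : ∀ x : ι → ℝ, Complex.exp ((∑ i, x i * θ i : ℝ) * Complex.I) =
      ∏ i, Complex.exp ((θ i : ℂ) * (x i : ℂ) * Complex.I) := by
    intro x
    rw [← Complex.exp_sum]
    push_cast
    rw [Finset.sum_mul]
    congr 1
    refine Finset.sum_congr rfl fun i _ => by ring
  simp_rw [this]
  rw [integral_fintype_prod_eq_prod
    (f := fun i (y : ℝ) => Complex.exp ((θ i : ℂ) * (y : ℂ) * Complex.I))]
  simp_rw [← charFun_apply_real, charFun_gaussianReal]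
  rw [← Complex.exp_sum]
  congr 1
  push_cast
  rw [neg_div, Finset.sum_div, ← Finset.sum_neg_distrib]
  refine Finset.sum_congr rfl fun i _ => by ring

theorem sum_shift_reindex {n : ℕ} (d : ℕ) (F : Fin n → Fin n → ℝ) :
    (∑ ℓ : Fin n, if d ≤ (ℓ : ℕ) then
        F ⟨(ℓ : ℕ) - d, lt_of_le_of_lt (Nat.sub_le _ _) ℓ.isLt⟩ ℓ else 0) =
      ∑ j : Fin n, if h : (j : ℕ) + d < n then F j ⟨j + d, h⟩ else 0 := by
  have h1 : ∀ ℓ : Fin n, (if d ≤ (ℓ : ℕ) then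
        F ⟨(ℓ : ℕ) - d, lt_of_le_of_lt (Nat.sub_le _ _) ℓ.isLt⟩ ℓ else 0) =
      ∑ j : Fin n, if (j : ℕ) + d = ℓ then F j ℓ else 0 := by
    intro ℓ
    split_ifs with h
    · rw [Finset.sum_eq_single ⟨(ℓ : ℕ) - d, lt_of_le_of_lt (Nat.sub_le _ _) ℓ.isLt⟩]
      · simp [Nat.sub_add_cancel h]
      · intro j _ hj
        rw [if_neg]
        intro hh
        exact hj (Fin.ext (by simp; omega))
      · simp
    · symm
      refine Finset.sum_eq_zero fun j _ => if_neg (by omega)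
  have h2 : ∀ j : Fin n, (if h : (j : ℕ) + d < n then F j ⟨j + d, h⟩ else 0) =
      ∑ ℓ : Fin n, if (j : ℕ) + d = ℓ then F j ℓ else 0 := by
    intro j
    split_ifs with h
    · rw [Finset.sum_eq_single ⟨j + d, h⟩]
      · simp
      · intro ℓ _ hℓ
        rw [if_neg]
        intro hh
        exact hℓ (Fin.ext (by simp; omega))
      · simp
    · symm
      refine Finset.sum_eq_zero fun ℓ _ => if_neg (by have := ℓ.isLt; omega)
  simp_rw [h1, h2]
  exact Finset.sum_comm

/-- The transpose of the shift. -/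
def unshift {n : ℕ} (d : ℕ) (c : Fin n → ℝ) (j : Fin n) : ℝ :=
  if h : (j : ℕ) + d < n then c ⟨j + d, h⟩ else 0

theorem sum_shift_mul {n : ℕ} (d : ℕ) (x c : Fin n → ℝ) :
    ∑ ℓ, shift d x ℓ * c ℓ = ∑ j, x j * unshift d c j := by
  have := sum_shift_reindex d fun j ℓ => x j * c ℓ
  simpa [shift, unshift, ite_mul, mul_dite] using this

theorem sum_unshift_sq {n : ℕ} (d : ℕ) (c : Fin n → ℝ) :
    ∑ j, unshift d c j ^ 2 = ∑ ℓ : Fin n, if d ≤ (ℓ : ℕ) then c ℓ ^ 2 else 0 := by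
  rw [sum_shift_reindex d fun _ ℓ => c ℓ ^ 2]
  refine Finset.sum_congr rfl fun j _ => ?_
  unfold unshift
  split_ifs <;> simp

theorem measurable_shift {n : ℕ} (d : ℕ) : Measurable fun x : Fin n → ℝ => shift d x := by
  refine measurable_pi_lambda _ fun ℓ => ?_
  unfold shift
  split_ifs
  · exact measurable_pi_apply _
  · exact measurable_const

/-- The superposition of shifted white Gaussian words has independent entries, and the variance
of an entry counts the words present. -/
theorem map_sum_shift_gaussian {κ : Type*} [Fintype κ] (n : ℕ) (d : κ → ℕ) (Q : ℝ≥0) :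
    (Measure.pi fun _ : κ => Measure.pi fun _ : Fin n => gaussianReal 0 Q).map
        (fun u ℓ => ∑ k, shift (d k) (u k) ℓ) =
      Measure.pi fun ℓ : Fin n =>
        gaussianReal 0 ((Finset.univ.filter fun k => d k ≤ (ℓ : ℕ)).card * Q) := by
  have hm : Measurable fun (u : κ → Fin n → ℝ) (ℓ : Fin n) => ∑ k, shift (d k) (u k) ℓ := by
    refine measurable_pi_lambda _ fun ℓ => Finset.measurable_sum _ fun k _ => ?_
    exact (measurable_pi_apply ℓ).comp ((measurable_shift (d k)).comp (measurable_pi_apply k))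
  have hp := Measure.isProbabilityMeasure_map (μ := (Measure.pi fun _ : κ =>
    Measure.pi fun _ : Fin n => gaussianReal 0 Q)) hm.aemeasurable
  refine Measure.ext_of_charFunDual ?_
  ext L
  set c : Fin n → ℝ := fun ℓ => L (Pi.single ℓ 1) with hc
  have hL : ∀ x : Fin n → ℝ, L x = ∑ i, x i * c i := by
    intro x
    conv_lhs => rw [pi_eq_sum_univ' x]
    simp [map_sum, hc]
  have hmexp : Measurable fun x : Fin n → ℝ => Complex.exp ((L x : ℂ) * Complex.I) := by
    fun_prop
  rw [charFunDual_apply, charFunDual_apply, integral_map hm.aemeasurable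
    hmexp.aestronglyMeasurable]
  simp_rw [hL]
  rw [integral_cexp_pi_gaussianReal]
  -- Transposing the shifts onto the test vector `c` makes the characteristic function factor over
  -- the words.
  have h1 : ∀ u : κ → Fin n → ℝ,
      Complex.exp ((∑ ℓ, (∑ k, shift (d k) (u k) ℓ) * c ℓ : ℝ) * Complex.I) =
      ∏ k, Complex.exp ((∑ j, u k j * unshift (d k) c j : ℝ) * Complex.I) := by
    intro u
    rw [← Complex.exp_sum, ← Finset.sum_mul, ← Complex.ofReal_sum]
    simp_rw [← sum_shift_mul, Finset.sum_mul]
    rw [Finset.sum_comm]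
  simp_rw [h1]
  rw [integral_fintype_prod_eq_prod (f := fun k (y : Fin n → ℝ) =>
    Complex.exp ((∑ j, y j * unshift (d k) c j : ℝ) * Complex.I))]
  simp_rw [integral_cexp_pi_gaussianReal]
  rw [← Complex.exp_sum, ← Complex.ofReal_sum]
  congr 2
  rw [← Finset.sum_div, Finset.sum_neg_distrib]
  congr 2
  -- The exponent is diagonal in `c`, because a word never puts one symbol at two channel uses; this
  -- is the independence of the entries.
  simp_rw [← Finset.mul_sum, sum_unshift_sq]
  rw [Finset.sum_comm, Finset.mul_sum]
  refine Finset.sum_congr rfl fun ℓ _ => ?_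
  rw [← Finset.sum_filter, Finset.sum_const]
  simp only [NNReal.coe_mul, NNReal.coe_natCast, nsmul_eq_mul]
  ring

theorem lintegral_exp_sum_sq_pi {n : ℕ} (v : Fin n → ℝ≥0) (p q r : Fin n → ℝ)
    (h : ∀ ℓ, 0 < 1 + v ℓ * p ℓ) :
    ∫⁻ y, ENNReal.ofReal (Real.exp (∑ ℓ, (r ℓ - (p ℓ * y ℓ ^ 2 + 2 * q ℓ * y ℓ) / 2)))
        ∂(Measure.pi fun ℓ => gaussianReal 0 (v ℓ)) =
      ENNReal.ofReal ((∏ ℓ, (√(1 + v ℓ * p ℓ))⁻¹) *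
        Real.exp (∑ ℓ, (r ℓ + v ℓ * q ℓ ^ 2 / (2 * (1 + v ℓ * p ℓ))))) := by
  simp_rw [Real.exp_sum]
  rw [← Finset.prod_mul_distrib, ENNReal.ofReal_prod_of_nonneg fun ℓ _ => by positivity]
  simp_rw [← lintegral_exp_quadratic_gaussianReal (v _) (p _) (q _) (r _) (h _)]
  rw [← lintegral_pi_prod (fun ℓ => gaussianReal 0 (v ℓ)) (fun ℓ y => ENNReal.ofReal
    (Real.exp (r ℓ - (p ℓ * y ^ 2 + 2 * q ℓ * y) / 2))) fun ℓ => by fun_prop]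
  refine lintegral_congr fun y => ?_
  rw [ENNReal.ofReal_prod_of_nonneg fun ℓ _ => by positivity]

theorem lintegral_exp_sq_noise {n : ℕ} (θ : ℝ) (hθ : θ < 1) (c g : Fin n → ℝ)
    (hc : ∀ ℓ, 0 ≤ c ℓ) :
    ∫⁻ z, ENNReal.ofReal (Real.exp (θ / 2 * ∑ ℓ, z ℓ ^ 2 - ∑ ℓ, c ℓ * (z ℓ + g ℓ) ^ 2 / 2))
        ∂(Measure.pi fun _ : Fin n => gaussianReal 0 1) =
      ENNReal.ofReal ((∏ ℓ, (√(1 - θ + c ℓ))⁻¹) *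
        Real.exp (-∑ ℓ, (1 - θ) * c ℓ / (1 - θ + c ℓ) * g ℓ ^ 2 / 2)) := by
  have hpos : ∀ ℓ, 0 < 1 - θ + c ℓ := fun ℓ => by linarith [hc ℓ]
  have := lintegral_exp_sum_sq_pi (fun _ : Fin n => 1) (fun ℓ => c ℓ - θ) (fun ℓ => c ℓ * g ℓ)
    (fun ℓ => -(c ℓ * g ℓ ^ 2 / 2)) (fun ℓ => by
      have := hpos ℓ
      simp only [NNReal.coe_one]
      linarith)
  simp only [NNReal.coe_one, one_mul] at this
  convert this using 4 with z
  · rw [Finset.mul_sum, ← Finset.sum_sub_distrib]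
    exact congrArg Real.exp (Finset.sum_congr rfl fun ℓ _ => by ring)
  · congr 2
    ring
  · rw [← Finset.sum_neg_distrib]
    refine Finset.sum_congr rfl fun ℓ _ => ?_
    have h1 := (hpos ℓ).ne'
    have h2 : 1 + (c ℓ - θ) = 1 - θ + c ℓ := by ring
    rw [h2]
    field_simp
    ring

theorem lintegral_exp_sub_shift {κ : Type*} [Fintype κ] {n : ℕ} (d : κ → ℕ) (Q : ℝ≥0)
    (lam w : Fin n → ℝ) (hlam : ∀ ℓ, 0 ≤ lam ℓ) :
    ∫⁻ u, ENNReal.ofReal (Real.exp (-∑ ℓ, lam ℓ * (w ℓ - ∑ k, shift (d k) (u k) ℓ) ^ 2 / 2))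
        ∂(Measure.pi fun _ : κ => Measure.pi fun _ : Fin n => gaussianReal 0 Q) =
      ENNReal.ofReal
        ((∏ ℓ : Fin n, (√(1 + (Finset.univ.filter fun k => d k ≤ (ℓ : ℕ)).card * Q * lam ℓ))⁻¹) *
          Real.exp (-∑ ℓ : Fin n, lam ℓ /
            (1 + (Finset.univ.filter fun k => d k ≤ (ℓ : ℕ)).card * Q * lam ℓ) * w ℓ ^ 2 / 2)) := by
  have hm : Measurable fun (u : κ → Fin n → ℝ) (ℓ : Fin n) => ∑ k, shift (d k) (u k) ℓ := by
    refine measurable_pi_lambda _ fun ℓ => Finset.measurable_sum _ fun k _ => ?_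
    exact (measurable_pi_apply ℓ).comp ((measurable_shift (d k)).comp (measurable_pi_apply k))
  have h1 := lintegral_map (μ := Measure.pi fun _ : κ => Measure.pi fun _ : Fin n =>
    gaussianReal 0 Q) (f := fun y : Fin n → ℝ => ENNReal.ofReal
      (Real.exp (-∑ ℓ, lam ℓ * (w ℓ - y ℓ) ^ 2 / 2))) (by fun_prop) hm
  rw [← h1, map_sum_shift_gaussian]
  have hpos : ∀ ℓ : Fin n, 0 < 1 + (((Finset.univ.filter fun k => d k ≤ (ℓ : ℕ)).card * Q : ℝ≥0) : ℝ)
      * lam ℓ := fun ℓ => by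
    have := hlam ℓ
    positivity
  have := lintegral_exp_sum_sq_pi
    (fun ℓ : Fin n => (Finset.univ.filter fun k => d k ≤ (ℓ : ℕ)).card * Q)
    lam (fun ℓ => -(lam ℓ * w ℓ)) (fun ℓ => -(lam ℓ * w ℓ ^ 2 / 2)) hpos
  convert this using 4 with y
  · rw [← Finset.sum_neg_distrib]
    exact congrArg Real.exp (Finset.sum_congr rfl fun ℓ _ => by ring)
  · push_cast
    rfl
  · rw [← Finset.sum_neg_distrib]
    refine Finset.sum_congr rfl fun ℓ _ => ?_
    have := hpos ℓ
    push_cast at this ⊢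
    generalize hx : ((Finset.univ.filter fun k => d k ≤ (ℓ : ℕ)).card : ℝ) * Q = x at this ⊢
    generalize lam ℓ = a at this ⊢
    have h0 : 1 + x * a ≠ 0 := this.ne'
    have h1 : a / (1 + x * a) = a - x * a ^ 2 / (1 + x * a) := by
      rw [eq_sub_iff_add_eq, ← add_div, div_eq_iff h0]
      ring
    rw [h1, mul_comm 2, ← div_div]
    ring

end Integrals

/-! ### Product measures: splitting, re-indexing, truncation. -/

section ProductMeasures

variable {ι : Type*} [Fintype ι] {X : Type*} [MeasurableSpace X]

theorem lintegral_pi_split (μ : Measure X) [IsProbabilityMeasure μ] (p : ι → Prop)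
    [DecidablePred p] [i₁ : Fintype {i // p i}] [i₂ : Fintype {i // ¬p i}]
    (F : (ι → X) → ℝ≥0∞) (hF : Measurable F) :
    ∫⁻ c, F c ∂(Measure.pi fun _ : ι => μ) =
      ∫⁻ x, ∫⁻ y, F (fun i => if h : p i then x ⟨i, h⟩ else y ⟨i, h⟩)
        ∂(Measure.pi fun _ : {i // ¬p i} => μ) ∂(Measure.pi fun _ : {i // p i} => μ) := by
  obtain rfl : i₁ = Subtype.fintype p := Subsingleton.elim _ _
  obtain rfl : i₂ = Subtype.fintype fun i => ¬p i := Subsingleton.elim _ _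
  have h := (measurePreserving_piEquivPiSubtypeProd (fun _ : ι => μ) p).symm
  rw [← h.lintegral_comp hF, lintegral_prod]
  · rfl
  · exact (hF.comp (MeasurableEquiv.measurable _)).aemeasurable

theorem map_pi_comp_injective {κ : Type*} [Fintype κ] (μ : Measure X) [IsProbabilityMeasure μ]
    {j : κ → ι} (hj : Function.Injective j) :
    (Measure.pi fun _ : ι => μ).map (fun c k => c (j k)) = Measure.pi fun _ : κ => μ := by
  have h := (iIndepFun_pi (μ := fun _ : ι => μ) (X := fun _ => id)
    fun _ => aemeasurable_id).precomp hj
  have h2 := (iIndepFun_iff_map_fun_eq_pi_map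
    (fun k => (measurable_pi_apply (j k)).aemeasurable)).1 h
  refine h2.trans ?_
  congr 1
  ext k : 1
  exact (measurePreserving_eval (fun _ : ι => μ) (j k)).map_eq

theorem lintegral_pi_comp_injective {κ : Type*} [Fintype κ] (μ : Measure X)
    [IsProbabilityMeasure μ] {j : κ → ι} (hj : Function.Injective j) (F : (κ → X) → ℝ≥0∞)
    (hF : Measurable F) :
    ∫⁻ x, F x ∂(Measure.pi fun _ : κ => μ) =
      ∫⁻ c, F (fun k => c (j k)) ∂(Measure.pi fun _ : ι => μ) := by
  rw [← map_pi_comp_injective μ hj, lintegral_map hF (by fun_prop)]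

/-- Passing from truncated to full Gaussian words costs one factor `C` per word. Below it is applied
to at most `K` words at a time, so the cost does not grow with `M`. -/
theorem pi_smul_restrict_le (μ : Measure X) [IsFiniteMeasure μ] (B : Set X) (C : ℝ≥0∞)
    (hC : C ≠ ∞) :
    (Measure.pi fun _ : ι => C • μ.restrict B) ≤
      C ^ Fintype.card ι • Measure.pi fun _ : ι => μ := by
  have : IsFiniteMeasure (C • μ.restrict B) := Measure.smul_finite _ hC
  have h : (Measure.pi fun _ : ι => C • μ.restrict B) =
      C ^ Fintype.card ι • Measure.pi fun _ : ι => μ.restrict B := by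
    refine Measure.pi_eq fun s _ => ?_
    simp [Measure.smul_apply, Measure.pi_pi, Finset.prod_mul_distrib]
  rw [h, ← Measure.restrict_pi_pi]
  gcongr
  exact Measure.restrict_le_self

end ProductMeasures

/-! ### The part of the signal that a wrong candidate leaves unexplained. -/

section RandomCoding

variable {n M K Dm : ℕ}

/-- The received word minus the superposition of the codewords that a candidate tuple shares with
the true one: the positions off `R` carry the codewords of the users `π k`. -/
def residual (D : DelayVector K Dm) (R : Finset (Fin K)) (π : Fin K → Fin K)
    (X : Fin K → Fin n → ℝ) (ℓ : Fin n) : ℝ :=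
  ∑ k, shift (D.d k) (X k) ℓ - ∑ k ∈ Rᶜ, shift (D.d k) (X (π k)) ℓ

theorem measurable_residual (D : DelayVector K Dm) (R : Finset (Fin K)) (π : Fin K → Fin K)
    (ℓ : Fin n) : Measurable fun X : Fin K → Fin n → ℝ => residual D R π X ℓ := by
  unfold residual
  have h : ∀ k j : Fin K, Measurable fun X : Fin K → Fin n → ℝ => shift (D.d k) (X j) ℓ :=
    fun k j => (measurable_pi_apply ℓ).comp ((measurable_shift _).comp (measurable_pi_apply j))
  exact (Finset.measurable_sum _ fun k _ => h k k).sub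
    (Finset.measurable_sum _ fun k _ => h k (π k))

theorem card_filter_subtype_delay (D : DelayVector K Dm) (S : Finset (Fin K)) (p : Fin K → Prop)
    [Fintype {k // p k}] (hp : ∀ k, p k ↔ k ∈ S) (ℓ : Fin n) :
    (Finset.univ.filter fun k : {k // p k} => D.d k ≤ (ℓ : ℕ)).card = overlap n S D ℓ := by
  unfold overlap
  rw [← Finset.card_map (Function.Embedding.subtype _)]
  congr 1
  ext k
  simp only [Finset.mem_map, Finset.mem_filter, Finset.mem_univ, true_and,
    Function.Embedding.coe_subtype, Subtype.exists, exists_and_right, exists_eq_right]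
  rw [← hp k]
  constructor
  · rintro ⟨h1, h2⟩
    exact ⟨h1, h2⟩
  · rintro ⟨h1, h2⟩
    exact ⟨h1, h2⟩

/-- Condition on the words of the users outside `S`. Each word of `S` then enters once, under its
own delay, and the rest is a fixed offset; an offset can only decrease the integral of a Gaussian
bell. This also covers candidates that carry true messages under wrong delays. -/
theorem lintegral_residual_le (D : DelayVector K Dm) (Q : ℝ≥0) (R S : Finset (Fin K))
    (π : Fin K → Fin K) (hS : ∀ k ∉ R, π k ∉ S) (c : Fin n → ℝ) (hc : ∀ ℓ, 0 ≤ c ℓ) :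
    ∫⁻ X, ENNReal.ofReal (Real.exp (-∑ ℓ, c ℓ * residual D R π X ℓ ^ 2 / 2))
        ∂(Measure.pi fun _ : Fin K => Measure.pi fun _ : Fin n => gaussianReal 0 Q) ≤
      ENNReal.ofReal (∏ ℓ, (√(1 + overlap n S D ℓ * Q * c ℓ))⁻¹) := by
  classical
  rw [lintegral_pi_split _ (fun k => k ∉ S)]
  swap
  · have := measurable_residual (n := n) D R π
    fun_prop
  have key : ∀ x : {k // k ∉ S} → Fin n → ℝ,
      ∫⁻ y : {k // ¬k ∉ S} → Fin n → ℝ, ENNReal.ofReal (Real.exp (-∑ ℓ, c ℓ * residual D R π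
        (fun i => if h : i ∉ S then x ⟨i, h⟩ else y ⟨i, h⟩) ℓ ^ 2 / 2))
        ∂(Measure.pi fun _ => Measure.pi fun _ : Fin n => gaussianReal 0 Q) ≤
      ENNReal.ofReal (∏ ℓ, (√(1 + overlap n S D ℓ * Q * c ℓ))⁻¹) := by
    intro x
    -- The offset fixed by the conditioning; `hS` ensures that the default `0` is never used.
    set f : Fin n → ℝ := fun ℓ => ∑ k ∈ Rᶜ, shift (D.d k)
        (if h : π k ∉ S then x ⟨π k, h⟩ else 0) ℓ - ∑ k : {k // k ∉ S}, shift (D.d k) (x k) ℓ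
      with hf
    have hres : ∀ (y : {k // ¬k ∉ S} → Fin n → ℝ) ℓ, residual D R π
        (fun i => if h : i ∉ S then x ⟨i, h⟩ else y ⟨i, h⟩) ℓ ^ 2 =
        (f ℓ - ∑ k : {k // ¬k ∉ S}, shift (D.d k) (y k) ℓ) ^ 2 := by
      intro y ℓ
      have h1 : ∑ k, shift (D.d k) (if h : k ∉ S then x ⟨k, h⟩ else y ⟨k, h⟩) ℓ =
          ∑ k : {k // k ∉ S}, shift (D.d k) (x k) ℓ +
            ∑ k : {k // ¬k ∉ S}, shift (D.d k) (y k) ℓ := by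
        rw [← Fintype.sum_subtype_add_sum_subtype (fun k => k ∉ S)]
        congr 1
        · refine Finset.sum_congr rfl fun k _ => ?_
          rw [dif_pos k.2]
        · refine Finset.sum_congr rfl fun k _ => ?_
          rw [dif_neg k.2]
      have h2 : ∑ k ∈ Rᶜ, shift (D.d k) (if h : π k ∉ S then x ⟨π k, h⟩ else y ⟨π k, h⟩) ℓ =
          ∑ k ∈ Rᶜ, shift (D.d k) (if h : π k ∉ S then x ⟨π k, h⟩ else 0) ℓ := by
        refine Finset.sum_congr rfl fun k hk => ?_
        rw [dif_pos (hS k (by simpa using hk)), dif_pos (hS k (by simpa using hk))]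
      simp only [residual, h1, h2, hf]
      ring
    simp_rw [hres]
    rw [lintegral_exp_sub_shift (fun k : {k // ¬k ∉ S} => D.d k) Q c f hc]
    simp_rw [card_filter_subtype_delay D S (fun k => ¬k ∉ S) (fun k => not_not)]
    refine ENNReal.ofReal_le_ofReal (mul_le_of_le_one_right (by positivity) ?_)
    rw [Real.exp_le_one_iff, neg_nonpos]
    refine Finset.sum_nonneg fun ℓ _ => ?_
    have := hc ℓ
    positivity
  calc _ ≤ ∫⁻ _ : {k // k ∉ S} → Fin n → ℝ,
        ENNReal.ofReal (∏ ℓ, (√(1 + overlap n S D ℓ * Q * c ℓ))⁻¹)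
        ∂(Measure.pi fun _ => Measure.pi fun _ : Fin n => gaussianReal 0 Q) :=
      lintegral_mono fun x => key x
    _ = _ := by rw [lintegral_const, measure_univ, mul_one]

/-- Integrating the noise first leaves a Gaussian bell in the residual with weights `(1 - θ) c / (1
- θ + c)`, to which `lintegral_residual_le` applies. -/
theorem lintegral_noise_residual_le (D : DelayVector K Dm) (Q : ℝ≥0) (R S : Finset (Fin K))
    (π : Fin K → Fin K) (hS : ∀ k ∉ R, π k ∉ S) (θ : ℝ) (hθ : θ < 1) (c : Fin n → ℝ)
    (hc : ∀ ℓ, 0 ≤ c ℓ) :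
    ∫⁻ X, ∫⁻ z, ENNReal.ofReal (Real.exp (θ / 2 * ∑ ℓ, z ℓ ^ 2 -
          ∑ ℓ, c ℓ * (z ℓ + residual D R π X ℓ) ^ 2 / 2))
        ∂(Measure.pi fun _ : Fin n => gaussianReal 0 1)
        ∂(Measure.pi fun _ : Fin K => Measure.pi fun _ : Fin n => gaussianReal 0 Q) ≤
      ENNReal.ofReal
        (∏ ℓ, (√(1 - θ + c ℓ + (1 - θ) * c ℓ * (overlap n S D ℓ * Q)))⁻¹) := by
  have hpos : ∀ ℓ, 0 < 1 - θ + c ℓ := fun ℓ => by linarith [hc ℓ]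
  have hκ : ∀ ℓ, 0 ≤ (1 - θ) * c ℓ / (1 - θ + c ℓ) := fun ℓ =>
    div_nonneg (mul_nonneg (by linarith) (hc ℓ)) (hpos ℓ).le
  simp_rw [lintegral_exp_sq_noise θ hθ c _ hc]
  have h0 : (0 : ℝ) ≤ ∏ ℓ, (√(1 - θ + c ℓ))⁻¹ := by positivity
  simp_rw [ENNReal.ofReal_mul h0]
  rw [lintegral_const_mul]
  swap
  · have := measurable_residual (n := n) D R π
    fun_prop
  refine (mul_le_mul_right (lintegral_residual_le D Q R S π hS _ hκ) _).trans ?_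
  rw [← ENNReal.ofReal_mul h0, ← Finset.prod_mul_distrib]
  refine le_of_eq ?_
  congr 1
  refine Finset.prod_congr rfl fun ℓ _ => ?_
  rw [← mul_inv, ← Real.sqrt_mul (hpos ℓ).le]
  congr 2
  have := (hpos ℓ).ne'
  field_simp

/-- The noise realizations and codebooks for which minimum distance decoding prefers the tuple
`m'` to the true tuple `m`. -/
def confusion (n : ℕ) (D : DelayVector K Dm) (m m' : Fin K → Fin M) :
    Set ((Fin M → Fin n → ℝ) × (Fin n → ℝ)) :=
  {p | ∑ ℓ, (p.2 ℓ + signal D (fun k => p.1 (m k)) ℓ - signal D (fun k => p.1 (m' k)) ℓ) ^ 2 ≤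
    ∑ ℓ, p.2 ℓ ^ 2}

theorem measurable_signal (D : DelayVector K Dm) (ℓ : Fin n) :
    Measurable fun x : Fin K → Fin n → ℝ => signal D x ℓ := by
  unfold signal
  exact Finset.measurable_sum _ fun k _ =>
    (measurable_pi_apply ℓ).comp ((measurable_shift _).comp (measurable_pi_apply k))

theorem measurableSet_confusion (D : DelayVector K Dm) (m m' : Fin K → Fin M) :
    MeasurableSet (confusion n D m m') := by
  have h : ∀ (m : Fin K → Fin M) (ℓ : Fin n), Measurable
      fun p : (Fin M → Fin n → ℝ) × (Fin n → ℝ) => signal D (fun k => p.1 (m k)) ℓ := fun m ℓ =>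
    (measurable_signal D ℓ).comp
      (measurable_pi_lambda _ fun k => (measurable_pi_apply (m k)).comp measurable_fst)
  exact measurableSet_le (by have := h m; have := h m'; fun_prop) (by fun_prop)

end RandomCoding

/-! ### Chernoff and union bounds over fresh codewords, given the true words and the noise. -/

section RandomCoding

variable {n M K Dm : ℕ}

/-- The bound, by the exponential Markov inequality with parameter `lam`, on the probability that
fresh codewords at the positions `R` beat the noise energy, given the residual signal `g` and the
noise `z`. -/
noncomputable def freshBound (D : DelayVector K Dm) (Q : ℝ≥0) (R : Finset (Fin K)) (lam : ℝ)
    (g z : Fin n → ℝ) : ℝ :=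
  (∏ ℓ, (√(1 + overlap n R D ℓ * Q * lam))⁻¹) * Real.exp (lam / 2 * ∑ ℓ, z ℓ ^ 2 -
    ∑ ℓ, lam / (1 + overlap n R D ℓ * Q * lam) * (z ℓ + g ℓ) ^ 2 / 2)

theorem freshBound_nonneg (D : DelayVector K Dm) (Q : ℝ≥0) (R : Finset (Fin K)) (lam : ℝ)
    (g z : Fin n → ℝ) : 0 ≤ freshBound D Q R lam g z := by
  unfold freshBound
  positivity

theorem freshBound_rpow (D : DelayVector K Dm) (Q : ℝ≥0) (R : Finset (Fin K)) (lam t : ℝ)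
    (g z : Fin n → ℝ) :
    freshBound D Q R lam g z ^ t = (∏ ℓ, (√(1 + overlap n R D ℓ * Q * lam))⁻¹) ^ t *
      Real.exp (t * lam / 2 * ∑ ℓ, z ℓ ^ 2 -
        ∑ ℓ, t * lam / (1 + overlap n R D ℓ * Q * lam) * (z ℓ + g ℓ) ^ 2 / 2) := by
  unfold freshBound
  rw [Real.mul_rpow (by positivity) (by positivity), ← Real.exp_mul]
  congr 2
  rw [sub_mul, Finset.sum_mul]
  congr 1
  · ring
  · refine Finset.sum_congr rfl fun ℓ _ => by ring

theorem measurable_freshBound (D : DelayVector K Dm) (Q : ℝ≥0) (R : Finset (Fin K)) (lam : ℝ)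
    (π : Fin K → Fin K) : Measurable fun p : (Fin K → Fin n → ℝ) × (Fin n → ℝ) =>
      freshBound D Q R lam (residual D R π p.1) p.2 := by
  unfold freshBound
  have h : ∀ ℓ, Measurable fun p : (Fin K → Fin n → ℝ) × (Fin n → ℝ) => residual D R π p.1 ℓ :=
    fun ℓ => (measurable_residual D R π ℓ).comp measurable_fst
  fun_prop

theorem measurable_freshBound_left (D : DelayVector K Dm) (Q : ℝ≥0) (R : Finset (Fin K)) (lam : ℝ)
    (π : Fin K → Fin K) (z : Fin n → ℝ) : Measurable fun X : Fin K → Fin n → ℝ =>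
      freshBound D Q R lam (residual D R π X) z := by
  unfold freshBound
  have h : ∀ ℓ, Measurable fun X : Fin K → Fin n → ℝ => residual D R π X ℓ :=
    fun ℓ => measurable_residual D R π ℓ
  fun_prop

variable (μ : Measure (Fin n → ℝ)) (B : Set (Fin n → ℝ)) (Q : ℝ≥0)
  (C : ℝ≥0∞)

/-- Exponential Markov inequality: the indicator of the energy comparison is at most the exponential
of `lam / 2` times the energy difference. The factor `C ^ K` pays for the truncation of the fresh
words. -/
theorem pi_fresh_le (hC1 : 1 ≤ C) (hC : C ≠ ∞)
    (hμ : μ = C • (Measure.pi fun _ : Fin n => gaussianReal 0 Q).restrict B)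
    (D : DelayVector K Dm) (R : Finset (Fin K)) (lam : ℝ) (hlam : 0 ≤ lam) (g z : Fin n → ℝ) :
    (Measure.pi fun _ : {k // k ∈ R} => μ)
        {u | ∑ ℓ, (z ℓ + g ℓ - ∑ k : {k // k ∈ R}, shift (D.d k) (u k) ℓ) ^ 2 ≤
          ∑ ℓ, z ℓ ^ 2} ≤
      C ^ K * ENNReal.ofReal (freshBound D Q R lam g z) := by
  have hmeas : ∀ ℓ, Measurable fun u : {k // k ∈ R} → Fin n → ℝ =>
      ∑ k : {k // k ∈ R}, shift (D.d k) (u k) ℓ := fun ℓ =>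
    Finset.measurable_sum _ fun k _ =>
      (measurable_pi_apply ℓ).comp ((measurable_shift (D.d k)).comp (measurable_pi_apply k))
  have hset : MeasurableSet {u : {k // k ∈ R} → Fin n → ℝ |
      ∑ ℓ, (z ℓ + g ℓ - ∑ k : {k // k ∈ R}, shift (D.d k) (u k) ℓ) ^ 2 ≤ ∑ ℓ, z ℓ ^ 2} :=
    measurableSet_le (by fun_prop) (by fun_prop)
  have hcard : C ^ Fintype.card {k // k ∈ R} ≤ C ^ K := by
    refine pow_le_pow_right₀ hC1 ?_
    rw [Fintype.card_coe]
    simpa using Finset.card_le_univ R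
  have hle := pi_smul_restrict_le (ι := {k // k ∈ R})
    (Measure.pi fun _ : Fin n => gaussianReal 0 Q) B C hC
  rw [← hμ] at hle
  refine (hle _).trans ?_
  rw [Measure.smul_apply, smul_eq_mul]
  refine mul_le_mul' hcard ?_
  rw [← lintegral_indicator_one hset]
  have hbd : ∀ u : {k // k ∈ R} → Fin n → ℝ, Set.indicator {u : {k // k ∈ R} → Fin n → ℝ |
      ∑ ℓ, (z ℓ + g ℓ - ∑ k : {k // k ∈ R}, shift (D.d k) (u k) ℓ) ^ 2 ≤ ∑ ℓ, z ℓ ^ 2}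
      (1 : ({k // k ∈ R} → Fin n → ℝ) → ℝ≥0∞) u ≤
      ENNReal.ofReal (Real.exp (lam / 2 * ∑ ℓ, z ℓ ^ 2)) *
        ENNReal.ofReal (Real.exp (-∑ ℓ, lam *
          (z ℓ + g ℓ - ∑ k : {k // k ∈ R}, shift (D.d k) (u k) ℓ) ^ 2 / 2)) := by
    intro u
    refine Set.indicator_apply_le' (fun hu => ?_) fun _ => zero_le
    rw [← ENNReal.ofReal_mul (by positivity), ← Real.exp_add, Pi.one_apply,
      ENNReal.one_le_ofReal, Real.one_le_exp_iff]
    rw [← Finset.sum_div, ← Finset.mul_sum]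
    have : lam * ∑ ℓ, (z ℓ + g ℓ - ∑ k : {k // k ∈ R}, shift (D.d k) (u k) ℓ) ^ 2 ≤
        lam * ∑ ℓ, z ℓ ^ 2 := mul_le_mul_of_nonneg_left hu hlam
    linarith
  refine (lintegral_mono hbd).trans ?_
  rw [lintegral_const_mul _ (by fun_prop), lintegral_exp_sub_shift
    (fun k : {k // k ∈ R} => D.d k) Q (fun _ => lam) (fun ℓ => z ℓ + g ℓ) fun _ => hlam]
  simp_rw [card_filter_subtype_delay D R (fun k => k ∈ R) (fun k => Iff.rfl)]
  rw [← ENNReal.ofReal_mul (by positivity)]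
  refine ENNReal.ofReal_le_ofReal (le_of_eq ?_)
  rw [freshBound, sub_eq_add_neg, Real.exp_add]
  ring

theorem le_rpow_of_le_one {a b : ℝ≥0∞} (ha : a ≤ 1) (hab : a ≤ b) {t : ℝ} (ht0 : 0 ≤ t)
    (ht1 : t ≤ 1) : a ≤ b ^ t := by
  calc a = a ^ (1 : ℝ) := (ENNReal.rpow_one a).symm
    _ ≤ a ^ t := ENNReal.rpow_le_rpow_of_exponent_ge ha ht1
    _ ≤ b ^ t := ENNReal.rpow_le_rpow hab ht0

/-- Words at messages outside `m` are independent of the true ones, so given the latter every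
candidate of the pattern obeys the same Chernoff bound. The union bound is weakened to its `t`-th
power, which is legitimate for a probability and tames the factor `G.card`. -/
theorem pi_union_confusion_le [IsProbabilityMeasure μ] (hC1 : 1 ≤ C) (hC : C ≠ ∞)
    (hμ : μ = C • (Measure.pi fun _ : Fin n => gaussianReal 0 Q).restrict B)
    (D : DelayVector K Dm) (R : Finset (Fin K)) (π : Fin K → Fin K) (lam : ℝ) (hlam : 0 ≤ lam)
    (t : ℝ) (ht0 : 0 ≤ t) (ht1 : t ≤ 1) (m : Fin K → Fin M) (hm : Function.Injective m)
    (G : Finset (Fin K → Fin M)) (hinj : ∀ m' ∈ G, Function.Injective m')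
    (hfresh : ∀ m' ∈ G, ∀ k ∈ R, m' k ∉ Set.range m) (hold : ∀ m' ∈ G, ∀ k ∉ R, m' k = m (π k))
    (z : Fin n → ℝ) :
    (Measure.pi fun _ : Fin M => μ) {c | (c, z) ∈ ⋃ m' ∈ G, confusion n D m m'} ≤
      ∫⁻ X, (G.card * (C ^ K * ENNReal.ofReal (freshBound D Q R lam (residual D R π X) z))) ^ t
        ∂(Measure.pi fun _ : Fin K => μ) := by
  classical
  have hset : MeasurableSet {c : Fin M → Fin n → ℝ | (c, z) ∈ ⋃ m' ∈ G, confusion n D m m'} :=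
    measurable_prodMk_right
      (Finset.measurableSet_biUnion G fun m' _ => measurableSet_confusion D m m')
  -- The codebook splits into the words of the sent messages, `x`, and all others, `y`.
  rw [← lintegral_indicator_one hset, lintegral_pi_split μ (fun i => i ∈ Set.range m) _
    (measurable_one.indicator hset)]
  have hFm : Measurable fun X : Fin K → Fin n → ℝ =>
      (G.card * (C ^ K * ENNReal.ofReal (freshBound D Q R lam (residual D R π X) z))) ^ t := by
    have h1 : Measurable fun X : Fin K → Fin n → ℝ =>
        freshBound D Q R lam (residual D R π X) z := measurable_freshBound_left D Q R lam π z
    fun_prop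
  have hj : Function.Injective fun k => (⟨m k, Set.mem_range_self k⟩ : {i // i ∈ Set.range m}) :=
    fun k k' h => hm (congrArg Subtype.val h)
  have hchange := lintegral_pi_comp_injective μ hj _ hFm
  refine le_trans ?_ hchange.ge
  refine lintegral_mono fun x => ?_
  set X : Fin K → Fin n → ℝ := fun k => x ⟨m k, Set.mem_range_self k⟩ with hX
  set comb : ({i // ¬i ∈ Set.range m} → Fin n → ℝ) → Fin M → Fin n → ℝ :=
    fun y i => if h : i ∈ Set.range m then x ⟨i, h⟩ else y ⟨i, h⟩ with hcomb
  have hcm : Measurable comb := by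
    refine measurable_pi_lambda _ fun i => ?_
    simp only [hcomb]
    split_ifs
    · exact measurable_const
    · exact measurable_pi_apply _
  change ∫⁻ y, Set.indicator {c : Fin M → Fin n → ℝ | (c, z) ∈ ⋃ m' ∈ G, confusion n D m m'} 1
    (comb y) ∂(Measure.pi fun _ => μ) ≤ _
  have hpre : ∀ y, Set.indicator {c : Fin M → Fin n → ℝ | (c, z) ∈ ⋃ m' ∈ G, confusion n D m m'}
      (1 : (Fin M → Fin n → ℝ) → ℝ≥0∞) (comb y) = Set.indicator
        (⋃ m' ∈ G, {y | (comb y, z) ∈ confusion n D m m'}) 1 y := by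
    intro y
    simp [Set.indicator_apply]
  simp_rw [hpre]
  have hU : MeasurableSet (⋃ m' ∈ G, {y | (comb y, z) ∈ confusion n D m m'}) :=
    Finset.measurableSet_biUnion G fun m' _ =>
      (hcm.prodMk measurable_const) (measurableSet_confusion D m m')
  rw [lintegral_indicator_one hU]
  refine le_rpow_of_le_one prob_le_one ?_ ht0 ht1
  refine (measure_biUnion_finset_le G _).trans ?_
  rw [← nsmul_eq_mul]
  refine Finset.sum_le_card_nsmul _ _ _ fun m' hm' => ?_
  have hj' : Function.Injective fun k : {k // k ∈ R} =>
      (⟨m' k, hfresh m' hm' k k.2⟩ : {i // ¬i ∈ Set.range m}) :=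
    fun k k' h => Subtype.ext (hinj m' hm' (congrArg Subtype.val h))
  refine le_trans (le_of_eq ?_) (pi_fresh_le μ B Q C hC1 hC hμ D R lam hlam (residual D R π X) z)
  rw [← map_pi_comp_injective μ hj', Measure.map_apply (by fun_prop)]
  · congr 1
    ext y
    have h1 : ∀ k, comb y (m k) = X k := fun k => by
      simp only [hcomb, hX]
      exact dif_pos (Set.mem_range_self k)
    have h2 : ∀ k : {k // k ∈ R}, comb y (m' k) = y ⟨m' k, hfresh m' hm' k k.2⟩ := fun k => by
      simp only [hcomb]
      rw [dif_neg]
    have h3 : ∀ ℓ, signal D (fun k => comb y (m' k)) ℓ =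
        ∑ k ∈ Rᶜ, shift (D.d k) (X (π k)) ℓ +
          ∑ k : {k // k ∈ R}, shift (D.d k) (y ⟨m' k, hfresh m' hm' k k.2⟩) ℓ := by
      intro ℓ
      rw [signal, ← Finset.sum_compl_add_sum R]
      congr 1
      · refine Finset.sum_congr rfl fun k hk => ?_
        rw [hold m' hm' k (by simpa using hk), h1]
      · rw [← Finset.sum_coe_sort R]
        exact Finset.sum_congr rfl fun k _ => by rw [h2]
    simp only [confusion, Set.mem_ofPred_eq, Set.mem_preimage, h3, h1]
    have h4 : ∀ ℓ, z ℓ + signal D X ℓ - (∑ k ∈ Rᶜ, shift (D.d k) (X (π k)) ℓ +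
          ∑ k : {k // k ∈ R}, shift (D.d k) (y ⟨m' k, hfresh m' hm' k k.2⟩) ℓ) =
        z ℓ + residual D R π X ℓ -
          ∑ k : {k // k ∈ R}, shift (D.d k) (y ⟨m' k, hfresh m' hm' k k.2⟩) ℓ := by
      intro ℓ
      simp only [residual, signal]
      ring
    have h5 : signal D (fun k => X k) = signal D X := rfl
    simp only [h5, h4]
  · have hmeas : ∀ ℓ, Measurable fun u : {k // k ∈ R} → Fin n → ℝ =>
        ∑ k : {k // k ∈ R}, shift (D.d k) (u k) ℓ := fun ℓ =>
      Finset.measurable_sum _ fun k _ =>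
        (measurable_pi_apply ℓ).comp ((measurable_shift (D.d k)).comp (measurable_pi_apply k))
    exact measurableSet_le (by fun_prop) (by fun_prop)

end RandomCoding

/-! ### Averaging over the true words and the noise. -/

section RandomCoding

variable {n M K Dm : ℕ}

theorem lintegral_freshBound_rpow_le (D : DelayVector K Dm) (Q : ℝ≥0) (R S : Finset (Fin K))
    (π : Fin K → Fin K) (hS : ∀ k ∉ R, π k ∉ S) (lam t : ℝ) (hlam : 0 ≤ lam) (ht0 : 0 ≤ t)
    (hlt : t * lam < 1) :
    ∫⁻ X, ∫⁻ z, ENNReal.ofReal (freshBound D Q R lam (residual D R π X) z ^ t)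
        ∂(Measure.pi fun _ : Fin n => gaussianReal 0 1)
        ∂(Measure.pi fun _ : Fin K => Measure.pi fun _ : Fin n => gaussianReal 0 Q) ≤
      ENNReal.ofReal ((∏ ℓ : Fin n, (√(1 + overlap n R D ℓ * Q * lam))⁻¹) ^ t *
        ∏ ℓ : Fin n, (√(1 - t * lam + t * lam / (1 + overlap n R D ℓ * Q * lam) +
          (1 - t * lam) * (t * lam / (1 + overlap n R D ℓ * Q * lam)) *
            (overlap n S D ℓ * Q)))⁻¹) := by
  have h0 : (0 : ℝ) ≤ (∏ ℓ : Fin n, (√(1 + overlap n R D ℓ * Q * lam))⁻¹) ^ t := by positivity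
  simp_rw [freshBound_rpow, ENNReal.ofReal_mul h0]
  have hres : ∀ ℓ, Measurable fun X : Fin K → Fin n → ℝ => residual D R π X ℓ :=
    fun ℓ => measurable_residual D R π ℓ
  have hm1 : Measurable fun p : (Fin K → Fin n → ℝ) × (Fin n → ℝ) =>
      ENNReal.ofReal (Real.exp (t * lam / 2 * ∑ ℓ, p.2 ℓ ^ 2 -
        ∑ ℓ, t * lam / (1 + overlap n R D ℓ * Q * lam) *
          (p.2 ℓ + residual D R π p.1 ℓ) ^ 2 / 2)) := by
    have h : ∀ ℓ, Measurable fun p : (Fin K → Fin n → ℝ) × (Fin n → ℝ) =>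
      residual D R π p.1 ℓ := fun ℓ => (measurable_residual D R π ℓ).comp measurable_fst
    fun_prop
  have hin : ∀ X : Fin K → Fin n → ℝ, ∫⁻ z : Fin n → ℝ,
      ENNReal.ofReal ((∏ ℓ : Fin n, (√(1 + overlap n R D ℓ * Q * lam))⁻¹) ^ t) *
      ENNReal.ofReal (Real.exp (t * lam / 2 * ∑ ℓ, z ℓ ^ 2 -
        ∑ ℓ, t * lam / (1 + overlap n R D ℓ * Q * lam) *
          (z ℓ + residual D R π X ℓ) ^ 2 / 2))
        ∂(Measure.pi fun _ : Fin n => gaussianReal 0 1) =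
      ENNReal.ofReal ((∏ ℓ : Fin n, (√(1 + overlap n R D ℓ * Q * lam))⁻¹) ^ t) *
      ∫⁻ z : Fin n → ℝ, ENNReal.ofReal (Real.exp (t * lam / 2 * ∑ ℓ, z ℓ ^ 2 -
        ∑ ℓ, t * lam / (1 + overlap n R D ℓ * Q * lam) *
          (z ℓ + residual D R π X ℓ) ^ 2 / 2))
        ∂(Measure.pi fun _ : Fin n => gaussianReal 0 1) := fun X =>
    lintegral_const_mul _ (by fun_prop)
  simp_rw [hin]
  rw [lintegral_const_mul _ hm1.lintegral_prod_right']
  refine mul_le_mul_right (lintegral_noise_residual_le D Q R S π hS (t * lam) hlt _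
    fun ℓ => ?_) _
  positivity

/-- Of the factor `C ^ (2 * K)`, one half comes from the fresh words and one from replacing the `K`
true words by full Gaussian ones. -/
theorem prod_union_confusion_le (μ : Measure (Fin n → ℝ)) [IsProbabilityMeasure μ]
    (B : Set (Fin n → ℝ)) (Q : ℝ≥0) (C : ℝ≥0∞) (hC1 : 1 ≤ C) (hC : C ≠ ∞)
    (hμ : μ = C • (Measure.pi fun _ : Fin n => gaussianReal 0 Q).restrict B)
    (D : DelayVector K Dm) (R S : Finset (Fin K)) (π : Fin K → Fin K)
    (hS : ∀ k ∉ R, π k ∉ S) (lam t : ℝ) (hlam : 0 ≤ lam) (ht0 : 0 ≤ t) (ht1 : t ≤ 1)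
    (hlt : t * lam < 1) (m : Fin K → Fin M) (hm : Function.Injective m)
    (G : Finset (Fin K → Fin M)) (hinj : ∀ m' ∈ G, Function.Injective m')
    (hfresh : ∀ m' ∈ G, ∀ k ∈ R, m' k ∉ Set.range m)
    (hold : ∀ m' ∈ G, ∀ k ∉ R, m' k = m (π k)) :
    ((Measure.pi fun _ : Fin M => μ).prod (Measure.pi fun _ : Fin n => gaussianReal 0 1))
        (⋃ m' ∈ G, confusion n D m m') ≤
      C ^ (2 * K) * ENNReal.ofReal ((G.card : ℝ) ^ t *
        ((∏ ℓ : Fin n, (√(1 + overlap n R D ℓ * Q * lam))⁻¹) ^ t *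
        ∏ ℓ : Fin n, (√(1 - t * lam + t * lam / (1 + overlap n R D ℓ * Q * lam) +
          (1 - t * lam) * (t * lam / (1 + overlap n R D ℓ * Q * lam)) *
            (overlap n S D ℓ * Q)))⁻¹)) := by
  have hset : MeasurableSet (⋃ m' ∈ G, confusion n D m m') :=
    Finset.measurableSet_biUnion G fun m' _ => measurableSet_confusion D m m'
  rw [Measure.prod_apply_symm hset]
  set W : (Fin K → Fin n → ℝ) → (Fin n → ℝ) → ℝ≥0∞ := fun X z =>
    ENNReal.ofReal (freshBound D Q R lam (residual D R π X) z ^ t) with hW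
  have hWm : Measurable fun p : (Fin K → Fin n → ℝ) × (Fin n → ℝ) => W p.1 p.2 := by
    have := measurable_freshBound (n := n) D Q R lam π
    simp only [hW]
    fun_prop
  have hWm' : ∀ z, Measurable fun X => W X z := by
    intro z
    have := measurable_freshBound_left (n := n) D Q R lam π z
    simp only [hW]
    fun_prop
  set A : ℝ≥0∞ := ENNReal.ofReal ((G.card : ℝ) ^ t) * C ^ K with hA
  have hAt : A ≠ ∞ := ENNReal.mul_ne_top ENNReal.ofReal_ne_top (ENNReal.pow_ne_top hC)
  have hpow : ∀ X z, ((G.card : ℝ≥0∞) *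
      (C ^ K * ENNReal.ofReal (freshBound D Q R lam (residual D R π X) z))) ^ t ≤ A * W X z := by
    intro X z
    rw [ENNReal.mul_rpow_of_nonneg _ _ ht0, ENNReal.mul_rpow_of_nonneg _ _ ht0, ← mul_assoc, hA,
      hW, ENNReal.ofReal_rpow_of_nonneg (freshBound_nonneg ..) ht0]
    refine mul_le_mul' (mul_le_mul' (le_of_eq ?_) ?_) le_rfl
    · rw [← ENNReal.ofReal_natCast, ENNReal.ofReal_rpow_of_nonneg (by positivity) ht0]
    · calc (C ^ K) ^ t ≤ (C ^ K) ^ (1 : ℝ) :=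
            ENNReal.rpow_le_rpow_of_exponent_le (one_le_pow₀ hC1) ht1
        _ = C ^ K := ENNReal.rpow_one _
  have hle := pi_smul_restrict_le (ι := Fin K)
    (Measure.pi fun _ : Fin n => gaussianReal 0 Q) B C hC
  rw [← hμ, Fintype.card_fin] at hle
  have hz : ∀ z, (Measure.pi fun _ : Fin M => μ)
      ((fun c => (c, z)) ⁻¹' ⋃ m' ∈ G, confusion n D m m') ≤
      A * C ^ K * ∫⁻ X, W X z ∂(Measure.pi fun _ : Fin K =>
        Measure.pi fun _ : Fin n => gaussianReal 0 Q) := by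
    intro z
    refine (pi_union_confusion_le μ B Q C hC1 hC hμ D R π lam hlam t ht0 ht1 m hm G hinj hfresh
      hold z).trans ?_
    refine (lintegral_mono fun X => hpow X z).trans ?_
    rw [lintegral_const_mul _ (hWm' z), mul_assoc A]
    refine mul_le_mul' le_rfl ?_
    refine (lintegral_mono' hle le_rfl).trans (le_of_eq ?_)
    rw [lintegral_smul_measure, smul_eq_mul]
  refine (lintegral_mono hz).trans ?_
  -- Tonelli: the Gaussian computation needs the noise as the inner variable.
  rw [lintegral_const_mul _ hWm.lintegral_prod_left', lintegral_lintegral_swap]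
  swap
  · exact (hWm.comp measurable_swap).aemeasurable
  refine (mul_le_mul' le_rfl (lintegral_freshBound_rpow_le D Q R S π hS lam t hlam ht0
    hlt)).trans (le_of_eq ?_)
  rw [ENNReal.ofReal_mul (p := (G.card : ℝ) ^ t) (by positivity), hA]
  ring

end RandomCoding

/-! ### Comparison of exponents and the gain from surplus power. -/

section Exponent

/-- `A` stems from the fresh positions and `B` from the missed users; for `A = B` the right side is
Gallager's `A ^ t`. If `A ≤ B`, the last factor is at least `1`; if `B ≤ A`, Bernoulli's inequality
for `(B / A) ^ t` gives the bound. -/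
theorem rpow_le_gallager_factor {A B W t : ℝ} (hW : 0 < W) (hA : W ≤ A) (hB : W ≤ B)
    (ht0 : 0 ≤ t) (ht1 : t ≤ 1) : W ^ t ≤ A ^ t * ((A + t * B) / (A * (1 + t))) := by
  have hA0 : 0 < A := hW.trans_le hA
  have hB0 : 0 < B := hW.trans_le hB
  rcases le_total A B with h | h
  · calc W ^ t ≤ A ^ t := Real.rpow_le_rpow hW.le hA ht0
      _ ≤ A ^ t * ((A + t * B) / (A * (1 + t))) := by
        refine le_mul_of_one_le_right (by positivity) ?_
        rw [one_le_div (by positivity)]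
        nlinarith
  · have hb := rpow_one_add_le_one_add_mul_self (s := B / A - 1)
      (by linarith [div_pos hB0 hA0]) ht0 ht1
    calc W ^ t ≤ B ^ t := Real.rpow_le_rpow hW.le hB ht0
      _ = A ^ t * (B / A) ^ t := by
        rw [← Real.mul_rpow hA0.le (by positivity)]
        congr 1
        field_simp
      _ ≤ A ^ t * ((A + t * B) / (A * (1 + t))) := by
        refine mul_le_mul_of_nonneg_left ?_ (by positivity)
        rw [add_sub_cancel] at hb
        refine hb.trans ?_
        have hr : B / A ≤ 1 := (div_le_one hA0).2 h
        have : (A + t * B) / (A * (1 + t)) = (1 + t * (B / A)) / (1 + t) := by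
          field_simp
        rw [this, le_div_iff₀ (by linarith)]
        nlinarith [mul_nonneg (mul_nonneg ht0 ht0) (sub_nonneg.2 hr)]

/-- Gallager's exponent dominates the exponent `E`. With `b = x / (1 + x)` the claim is `log (1 - b
t²) ≤ t log (1 - b t / (1 + t))`; bound the left by `log u ≤ u - 1` and the right by `log u ≥ 1 -
1/u`. -/
theorem log_dependence_testing_le {x t : ℝ} (hx : 0 ≤ x) (ht0 : 0 ≤ t) (ht1 : t < 1) :
    t * Real.log (1 + x) + Real.log (1 - x * t ^ 2 / (1 + x)) ≤
      t * Real.log (1 + x / (1 + t)) := by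
  have hx1 : 0 < 1 + x := by linarith
  have h1t : 0 < 1 + t := by linarith
  set b := x / (1 + x) with hb
  have hb0 : 0 ≤ b := by positivity
  have hb1 : b < 1 := (div_lt_one hx1).2 (by linarith)
  have e1 : 1 - x * t ^ 2 / (1 + x) = 1 - b * t ^ 2 := by rw [hb]; ring
  have e2 : 1 + x / (1 + t) = (1 + x) * ((1 + t - b * t) / (1 + t)) := by
    rw [hb]
    field_simp
    ring
  have h2 : 0 < 1 + t - b * t := by nlinarith
  rw [e1, e2, Real.log_mul hx1.ne' (by positivity), mul_add]
  have h3 : 0 < 1 - b * t ^ 2 := by nlinarith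
  have h4 : Real.log (1 - b * t ^ 2) ≤ -(b * t ^ 2) := by
    have := Real.log_le_sub_one_of_pos h3
    linarith
  have h5 := Real.one_sub_inv_le_log_of_pos (show 0 < (1 + t - b * t) / (1 + t) by positivity)
  have h6 : -(b * t ^ 2) ≤ t * (1 - ((1 + t - b * t) / (1 + t))⁻¹) := by
    have : t * (1 - ((1 + t - b * t) / (1 + t))⁻¹) = -(b * t ^ 2 / (1 + t - b * t)) := by
      have h8 : 1 - (1 + t) / (1 + t - b * t) = -(b * t) / (1 + t - b * t) := by
        rw [eq_div_iff h2.ne', sub_mul, div_mul_cancel₀ _ h2.ne']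
        ring
      rw [inv_div, h8]
      ring
    rw [this, neg_le_neg_iff, div_le_iff₀ h2]
    nlinarith [mul_nonneg hb0 (sq_nonneg t), mul_nonneg (mul_nonneg hb0 (sq_nonneg t))
      (mul_nonneg ht0 (sub_nonneg.2 hb1.le))]
  have h7 := mul_le_mul_of_nonneg_left h5 ht0
  linarith

/-- The ratio `(1 + t + a Q) / (1 + t + a P)` increases with `a` and decreases with `t`; the extreme
case `a = t = 1` gives the constant. -/
theorem log_power_gain_le {P Q a t : ℝ} (hP : 0 < P) (hPQ : P ≤ Q) (ha : 1 ≤ a) (ht0 : 0 ≤ t)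
    (ht1 : t ≤ 1) :
    Real.log (1 + a * P / (1 + t)) + Real.log ((2 + Q) / (2 + P)) ≤
      Real.log (1 + a * Q / (1 + t)) := by
  have hQ : 0 < Q := hP.trans_le hPQ
  rw [← Real.log_mul (by positivity) (by positivity)]
  refine Real.log_le_log (by positivity) ?_
  have e : ∀ y : ℝ, 1 + a * y / (1 + t) = (1 + t + a * y) / (1 + t) := fun y => by
    field_simp
  rw [e, e, div_mul_div_comm, div_le_div_iff₀ (by positivity) (by positivity)]
  have : 0 ≤ (Q - P) * (2 * a - (1 + t)) * (1 + t) :=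
    mul_nonneg (mul_nonneg (by linarith) (by linarith)) (by linarith)
  nlinarith

/-- The gain in the error exponent per channel use and unit of tilt from raising the power of the
codewords from `P` to `Q`. -/
noncomputable def powerGain (P Q : ℝ) : ℝ := 1 / 2 * Real.log ((2 + Q) / (2 + P))

theorem powerGain_pos {P Q : ℝ} (hP : 0 < P) (hPQ : P < Q) : 0 < powerGain P Q := by
  have : 1 < (2 + Q) / (2 + P) := by
    rw [one_lt_div (by linarith)]
    linarith
  have := Real.log_pos this
  unfold powerGain
  positivity

theorem log_factor_le {P Q t : ℝ} (hP : 0 < P) (hPQ : P ≤ Q) (a : ℕ) (ht0 : 0 ≤ t)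
    (ht1 : t < 1) :
    -(t / 2 * Real.log (1 + a * Q / (1 + t))) ≤
      -(1 / 2 * (t * Real.log (1 + a * P) + Real.log (1 - a * P * t ^ 2 / (1 + a * P)))) -
        if 1 ≤ a then powerGain P Q * t else 0 := by
  have h1 := log_dependence_testing_le (x := a * P) (by positivity) ht0 ht1
  split_ifs with ha
  · have h2 := mul_le_mul_of_nonneg_left (log_power_gain_le hP hPQ (a := a)
      (by exact_mod_cast ha) ht0 ht1.le) ht0
    unfold powerGain
    linarith
  · have : a = 0 := by omega
    subst this
    simp

theorem sum_ite_le {n : ℕ} (Dm : ℕ) (hDm : Dm ≤ n) (g : ℝ) :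
    ∑ ℓ : Fin n, (if Dm ≤ (ℓ : ℕ) then g else 0) = (n - Dm) * g := by
  have h := Fin.sum_univ_eq_sum_range (fun i => if Dm ≤ i then g else 0) n
  rw [h, ← Finset.sum_filter, Finset.sum_const, nsmul_eq_mul]
  congr 1
  have : (Finset.range n).filter (fun i => Dm ≤ i) = Finset.Ico Dm n := by
    ext i
    simp only [Finset.mem_filter, Finset.mem_range, Finset.mem_Ico]
    tauto
  rw [this, Nat.card_Ico, Nat.cast_sub hDm]

/-- The first user is never delayed, and from `Dm` on everyone is present. Allowing `ι` below `iota
S` lets one profile serve two sets of equal size. -/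
theorem worst_le_overlap {n K Dm : ℕ} (D : DelayVector K Dm) (S : Finset (Fin K)) (ι : ℕ)
    (hι : ι ≤ iota S) (ℓ : Fin n) : worst n Dm ι S.card ℓ ≤ overlap n S D ℓ := by
  unfold worst overlap
  split_ifs with h
  · refine hι.trans ?_
    unfold iota
    split_ifs with hex
    · obtain ⟨i, hi, hi0⟩ := hex
      refine Finset.card_pos.2 ⟨i, ?_⟩
      simp [hi, D.first i hi0]
    · exact Nat.zero_le _
  · rw [Finset.filter_true_of_mem fun i _ => (D.le_max i).trans (not_lt.1 h)]

/-- The tilt `1 / (1 + t)` brings each factor into the form of `rpow_le_gallager_factor`. The power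
gain is counted only at the `n - Dm` uses where the worst profile equals `s ≥ 1`. -/
theorem prod_factor_le {n Dm M s ι : ℕ} (hDm : Dm ≤ n) (hM : 1 ≤ M) (hs : 1 ≤ s) {P Q t : ℝ}
    (hP : 0 < P) (hPQ : P ≤ Q) (ht0 : 0 < t) (ht1 : t < 1) (a a' : Fin n → ℕ)
    (ha : ∀ ℓ, worst n Dm ι s ℓ ≤ a ℓ) (ha' : ∀ ℓ, worst n Dm ι s ℓ ≤ a' ℓ) :
    ((M : ℝ) ^ s) ^ t * ((∏ ℓ : Fin n, (√(1 + a ℓ * Q * (1 / (1 + t))))⁻¹) ^ t *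
      ∏ ℓ : Fin n, (√(1 - t * (1 / (1 + t)) + t * (1 / (1 + t)) / (1 + a ℓ * Q * (1 / (1 + t))) +
          (1 - t * (1 / (1 + t))) * (t * (1 / (1 + t)) / (1 + a ℓ * Q * (1 / (1 + t)))) *
            (a' ℓ * Q)))⁻¹) ≤
      g₁ M P s (worst n Dm ι s) t * Real.exp (-(powerGain P Q * t * (n - Dm))) := by
  have hQ : 0 < Q := hP.trans_le hPQ
  have h1t : 0 < 1 + t := by linarith
  have hgain : 0 ≤ powerGain P Q * t := by
    rcases hPQ.eq_or_lt with h | h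
    · subst h
      simp [powerGain, div_self (show 2 + P ≠ 0 by positivity)]
    · exact (mul_pos (powerGain_pos hP h) ht0).le
  have hfac : ∀ ℓ : Fin n, (√(1 + a ℓ * Q * (1 / (1 + t))))⁻¹ ^ t *
      (√(1 - t * (1 / (1 + t)) + t * (1 / (1 + t)) / (1 + a ℓ * Q * (1 / (1 + t))) +
          (1 - t * (1 / (1 + t))) * (t * (1 / (1 + t)) / (1 + a ℓ * Q * (1 / (1 + t)))) *
            (a' ℓ * Q)))⁻¹ ≤
      Real.exp (-(t / 2 * Real.log (1 + worst n Dm ι s ℓ * Q / (1 + t)))) := by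
    intro ℓ
    set A : ℝ := 1 + a ℓ * Q * (1 / (1 + t)) with hA
    set B : ℝ := 1 + a' ℓ * Q * (1 / (1 + t)) with hB
    set W : ℝ := 1 + worst n Dm ι s ℓ * Q / (1 + t) with hW
    have hW0 : 0 < W := by positivity
    have hA0 : 0 < A := by positivity
    have hB0 : 0 < B := by positivity
    have hWA : W ≤ A := by
      have : (worst n Dm ι s ℓ : ℝ) ≤ a ℓ := by exact_mod_cast ha ℓ
      rw [hW, hA, mul_one_div]
      gcongr
    have hWB : W ≤ B := by
      have : (worst n Dm ι s ℓ : ℝ) ≤ a' ℓ := by exact_mod_cast ha' ℓ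
      rw [hW, hB, mul_one_div]
      gcongr
    have e : 1 - t * (1 / (1 + t)) + t * (1 / (1 + t)) / A +
          (1 - t * (1 / (1 + t))) * (t * (1 / (1 + t)) / A) * (a' ℓ * Q) =
        (A + t * B) / (A * (1 + t)) := by
      rw [hB]
      clear_value A
      field_simp
      ring
    rw [e]
    have h := rpow_le_gallager_factor hW0 hWA hWB ht0.le ht1.le
    have h2 : (√A)⁻¹ ^ t * (√((A + t * B) / (A * (1 + t))))⁻¹ =
        (√(A ^ t * ((A + t * B) / (A * (1 + t)))))⁻¹ := by
      rw [Real.sqrt_mul (by positivity), mul_inv, Real.inv_rpow (by positivity),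
        Real.sqrt_eq_rpow, Real.sqrt_eq_rpow (A ^ t), ← Real.rpow_mul hA0.le,
        ← Real.rpow_mul hA0.le, mul_comm t (1 / 2)]
    have h3 : Real.exp (-(t / 2 * Real.log W)) = (√(W ^ t))⁻¹ := by
      rw [Real.exp_neg, Real.sqrt_eq_rpow, ← Real.rpow_mul hW0.le, Real.rpow_def_of_pos hW0]
      ring_nf
    rw [h2, h3]
    gcongr
  have hprod : (∏ ℓ : Fin n, (√(1 + a ℓ * Q * (1 / (1 + t))))⁻¹) ^ t *
      ∏ ℓ : Fin n, (√(1 - t * (1 / (1 + t)) + t * (1 / (1 + t)) / (1 + a ℓ * Q * (1 / (1 + t))) +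
          (1 - t * (1 / (1 + t))) * (t * (1 / (1 + t)) / (1 + a ℓ * Q * (1 / (1 + t)))) *
            (a' ℓ * Q)))⁻¹ ≤
      Real.exp (-E P (worst n Dm ι s) t - powerGain P Q * t * (n - Dm)) := by
    rw [← Real.finsetProd_rpow _ _ fun ℓ _ => by positivity, ← Finset.prod_mul_distrib]
    refine (Finset.prod_le_prod (fun ℓ _ => by positivity) fun ℓ _ => hfac ℓ).trans ?_
    rw [← Real.exp_sum]
    refine Real.exp_le_exp.2 ?_
    refine (Finset.sum_le_sum fun ℓ _ => log_factor_le hP hPQ _ ht0.le ht1).trans ?_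
    rw [Finset.sum_sub_distrib, E, Finset.mul_sum, Finset.sum_neg_distrib]
    refine sub_le_sub_left ?_ _
    rw [mul_comm _ ((n : ℝ) - Dm), ← sum_ite_le Dm hDm]
    refine Finset.sum_le_sum fun ℓ _ => ?_
    by_cases h : Dm ≤ (ℓ : ℕ)
    · have : 1 ≤ worst n Dm ι s ℓ := by
        unfold worst
        rwa [if_neg (not_lt.2 h)]
      rw [if_pos h, if_pos this]
    · rw [if_neg h]
      split_ifs
      · exact hgain
      · exact le_rfl
  have hMs : ((M : ℝ) ^ s) ^ t = Real.exp (t * s * Real.log M) := by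
    have hM0 : (0 : ℝ) < M := by exact_mod_cast hM
    rw [← Real.rpow_natCast, ← Real.rpow_mul hM0.le, Real.rpow_def_of_pos hM0]
    ring_nf
  calc _ ≤ ((M : ℝ) ^ s) ^ t *
        Real.exp (-E P (worst n Dm ι s) t - powerGain P Q * t * (n - Dm)) :=
      mul_le_mul_of_nonneg_left hprod (by positivity)
    _ = _ := by
      rw [hMs, g₁, ← Real.exp_add, ← Real.exp_add]
      congr 1
      ring

end Exponent

/-! ### Classification of wrong candidates by fresh positions and owners. -/

section Patterns

variable {n M K Dm : ℕ}

open Classical in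
/-- The candidate tuples of distinct messages that miss at least one message of `m`. -/
noncomputable def wrongTuples (m : Fin K → Fin M) : Finset (Fin K → Fin M) :=
  Finset.univ.filter fun m' => Function.Injective m' ∧ ∃ i, m i ∉ Set.range m'

open Classical in
/-- The positions at which the candidate `m'` carries a message outside `m`. -/
noncomputable def freshPositions (m m' : Fin K → Fin M) : Finset (Fin K) :=
  Finset.univ.filter fun k => m' k ∉ Set.range m

open Classical in
/-- At the positions that are not fresh, the user whose message the candidate `m'` carries. -/
noncomputable def owner (m m' : Fin K → Fin M) (k : Fin K) : Fin K :=
  if h : ∃ j, m j = m' k then h.choose else k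

theorem owner_spec (m m' : Fin K → Fin M) {k : Fin K} (hk : k ∉ freshPositions m m') :
    m' k = m (owner m m' k) := by
  have h : ∃ j, m j = m' k := by simpa [freshPositions] using hk
  rw [owner, dif_pos h, h.choose_spec]

/-- Within a pattern, a candidate is determined by its messages at the fresh positions. -/
theorem card_fresh_le (m : Fin K → Fin M) (R : Finset (Fin K)) (π : Fin K → Fin K)
    (G : Finset (Fin K → Fin M)) (hold : ∀ m' ∈ G, ∀ k ∉ R, m' k = m (π k)) :
    G.card ≤ M ^ R.card := by
  have h : G.card ≤ (Finset.univ : Finset (R → Fin M)).card := by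
    refine Finset.card_le_card_of_injOn (fun m' k => m' k) (fun _ _ => Finset.mem_univ _) ?_
    intro m₁ h₁ m₂ h₂ h
    funext k
    by_cases hk : k ∈ R
    · exact congrFun h ⟨k, hk⟩
    · rw [hold m₁ h₁ k hk, hold m₂ h₂ k hk]
  simpa using h

/-- The number of patterns depends on `K` only, so a bound per pattern and a union bound suffice. -/
theorem measure_wrongTuples_le (μ : Measure (Fin n → ℝ)) [IsProbabilityMeasure μ]
    (B : Set (Fin n → ℝ)) (Q : ℝ≥0) (C : ℝ≥0∞) (hC1 : 1 ≤ C) (hC : C ≠ ∞)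
    (hμ : μ = C • (Measure.pi fun _ : Fin n => gaussianReal 0 Q).restrict B)
    (D : DelayVector K Dm) (hDm : Dm ≤ n) {P : ℝ} (hP : 0 < P) (hPQ : P ≤ Q)
    (t : ℕ → ℕ → ℝ) (ht : ∀ T : Finset (Fin K), T.Nonempty → t (iota T) T.card ∈ Set.Ioo 0 1)
    (ε : ℝ) (hε : ∀ T : Finset (Fin K), T.Nonempty →
      g₁ M P T.card (worst n Dm (iota T) T.card) (t (iota T) T.card) *
        Real.exp (-(powerGain P Q * t (iota T) T.card * (n - Dm))) ≤ ε)
    (m : Fin K → Fin M) (hm : Function.Injective m) :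
    ((Measure.pi fun _ : Fin M => μ).prod (Measure.pi fun _ : Fin n => gaussianReal 0 1))
        (⋃ m' ∈ wrongTuples m, confusion n D m m') ≤
      Fintype.card (Finset (Fin K) × (Fin K → Fin K)) * (C ^ (2 * K) * ENNReal.ofReal ε) := by
  classical
  set G : Finset (Fin K) × (Fin K → Fin K) → Finset (Fin K → Fin M) := fun q =>
    (wrongTuples m).filter fun m' => freshPositions m m' = q.1 ∧ owner m m' = q.2 with hG
  have hcover : (⋃ m' ∈ wrongTuples m, confusion n D m m') ⊆
      ⋃ q ∈ (Finset.univ : Finset (Finset (Fin K) × (Fin K → Fin K))),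
        ⋃ m' ∈ G q, confusion n D m m' := by
    intro p hp
    simp only [Set.mem_iUnion] at hp ⊢
    obtain ⟨m', hm', hp⟩ := hp
    exact ⟨(freshPositions m m', owner m m'), Finset.mem_univ _, m',
      by simp [hG, hm'], hp⟩
  refine (measure_mono hcover).trans ((measure_biUnion_finset_le _ _).trans ?_)
  rw [← nsmul_eq_mul, ← Finset.card_univ]
  refine Finset.sum_le_card_nsmul _ _ _ fun q _ => ?_
  rcases (G q).eq_empty_or_nonempty with hq | ⟨m₀, hm₀⟩
  · rw [hq]
    simp
  obtain ⟨R, π⟩ := q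
  have hmem : ∀ m' ∈ G (R, π), Function.Injective m' ∧ (∃ i, m i ∉ Set.range m') ∧
      freshPositions m m' = R ∧ owner m m' = π := by
    intro m' hm'
    simp only [hG, wrongTuples, Finset.mem_filter, Finset.mem_univ, true_and] at hm'
    exact ⟨hm'.1.1, hm'.1.2, hm'.2.1, hm'.2.2⟩
  have hfresh : ∀ m' ∈ G (R, π), ∀ k ∈ R, m' k ∉ Set.range m := by
    intro m' hm' k hk
    rw [← (hmem m' hm').2.2.1] at hk
    simpa [freshPositions] using hk
  have hold : ∀ m' ∈ G (R, π), ∀ k ∉ R, m' k = m (π k) := by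
    intro m' hm' k hk
    rw [← (hmem m' hm').2.2.1] at hk
    rw [← (hmem m' hm').2.2.2]
    exact owner_spec m m' hk
  have hπ : Set.InjOn π (Rᶜ : Finset (Fin K)) := by
    intro k hk k' hk' h
    apply (hmem m₀ hm₀).1
    rw [hold m₀ hm₀ k (by simpa using hk), hold m₀ hm₀ k' (by simpa using hk'), h]
  -- The users whose messages are missing from the candidates of this pattern.
  set S : Finset (Fin K) := (Rᶜ.image π)ᶜ with hS
  have hSπ : ∀ k ∉ R, π k ∉ S := by
    intro k hk
    simp only [hS, Finset.mem_compl, Finset.mem_image, not_not]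
    exact ⟨k, hk, rfl⟩
  have hcard : S.card = R.card := by
    rw [hS, Finset.card_compl, Finset.card_image_of_injOn hπ, Finset.card_compl]
    have := Finset.card_le_univ R
    omega
  have hRne : R.Nonempty := by
    rw [Finset.nonempty_iff_ne_empty]
    rintro rfl
    obtain ⟨i, hi⟩ := (hmem m₀ hm₀).2.1
    -- Without fresh positions `π` would be a permutation, and the candidate would miss no message.
    have hsurj : Function.Surjective π := Finite.injective_iff_surjective.1
      fun k k' h => hπ (by simp) (by simp) h
    obtain ⟨k, rfl⟩ := hsurj i
    exact hi ⟨k, hold m₀ hm₀ k (by simp)⟩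
  have hSne : S.Nonempty := by
    rw [← Finset.card_pos, hcard]
    exact hRne.card_pos
  have hM : 1 ≤ M := by
    obtain ⟨k, -⟩ := hRne
    exact (m k).pos
  -- `R` and `S` may differ in whether they contain the first user; the profile with the smaller
  -- `iota` lies below both overlaps.
  obtain ⟨T, hTne, hTcard, hTR, hTS⟩ : ∃ T : Finset (Fin K), T.Nonempty ∧ T.card = R.card ∧
      iota T ≤ iota R ∧ iota T ≤ iota S := by
    rcases le_total (iota R) (iota S) with h | h
    · exact ⟨R, hRne, rfl, le_rfl, h⟩
    · exact ⟨S, hSne, hcard, h, le_rfl⟩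
  obtain ⟨ht0, ht1⟩ := ht T hTne
  set τ := t (iota T) T.card with hτ
  have hlt : τ * (1 / (1 + τ)) < 1 := by
    rw [mul_one_div, div_lt_one (by linarith)]
    linarith
  refine (prod_union_confusion_le μ B Q C hC1 hC hμ D R S π hSπ (1 / (1 + τ)) τ (by positivity)
    ht0.le ht1.le hlt m hm (G (R, π)) (fun m' hm' => (hmem m' hm').1) hfresh hold).trans ?_
  refine mul_le_mul' le_rfl (ENNReal.ofReal_le_ofReal ?_)
  refine le_trans ?_ ((prod_factor_le (s := T.card) hDm hM hTne.card_pos hP hPQ ht0 ht1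
    (overlap n R D) (overlap n S D) (fun ℓ => ?_) (fun ℓ => ?_)).trans (hε T hTne))
  · refine mul_le_mul_of_nonneg_right ?_ (by positivity)
    refine Real.rpow_le_rpow (by positivity) ?_ ht0.le
    rw [hTcard]
    exact_mod_cast card_fresh_le m R π (G (R, π)) hold
  · rw [hTcard]
    exact worst_le_overlap D R _ hTR ℓ
  · rw [hTcard, ← hcard]
    exact worst_le_overlap D S _ hTS ℓ

end Patterns

/-! ### Truncated Gaussian words and measurable decoders. -/

section Codes

variable {n M K Dm : ℕ}

/-- The words that satisfy the power constraint. -/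
def powerBall (n : ℕ) (P' : ℝ) : Set (Fin n → ℝ) := {x | ∑ j, x j ^ 2 ≤ n * P'}

theorem measurableSet_powerBall (n : ℕ) (P' : ℝ) : MeasurableSet (powerBall n P') :=
  measurableSet_le (by fun_prop) measurable_const

theorem lintegral_sq_gaussianReal (Q : ℝ≥0) :
    ∫⁻ y, ENNReal.ofReal (y ^ 2) ∂gaussianReal 0 Q = Q := by
  have hint : Integrable (fun y : ℝ => y ^ 2) (gaussianReal 0 Q) :=
    (memLp_id_gaussianReal 2).integrable_sq
  rw [← ofReal_integral_eq_lintegral_ofReal hint (ae_of_all _ fun y => sq_nonneg y)]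
  have h := variance_fun_id_gaussianReal (μ := 0) (v := Q)
  rw [variance_of_integral_eq_zero aemeasurable_id' (by simp)] at h
  rw [h, ENNReal.ofReal_coe_nnreal]

/-- Markov's inequality for the energy, whose mean is `n Q`. Far from sharp, but below `1` uniformly
in `n` when `Q < P'`, as the truncation constant requires. -/
theorem pi_gaussian_compl_powerBall_le (hn : 1 ≤ n) (Q : ℝ≥0) {P' : ℝ} (hP' : 0 < P') :
    (Measure.pi fun _ : Fin n => gaussianReal 0 Q) (powerBall n P')ᶜ ≤
      ENNReal.ofReal (Q / P') := by
  have hn0 : (0 : ℝ) < n := by exact_mod_cast hn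
  have hsub : (powerBall n P')ᶜ ⊆
      {x | ENNReal.ofReal (n * P') ≤ ∑ j, ENNReal.ofReal (x j ^ 2)} := by
    intro x hx
    rw [powerBall, Set.mem_compl_iff, Set.mem_ofPred_eq, not_le] at hx
    rw [Set.mem_ofPred_eq, ← ENNReal.ofReal_sum_of_nonneg fun j _ => sq_nonneg _]
    exact ENNReal.ofReal_le_ofReal hx.le
  have hpos : ENNReal.ofReal (n * P') ≠ 0 := by
    rw [Ne, ENNReal.ofReal_eq_zero, not_le]
    positivity
  refine (measure_mono hsub).trans ((meas_ge_le_lintegral_div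
    (Finset.measurable_sum _ fun j _ => by fun_prop).aemeasurable hpos
    ENNReal.ofReal_ne_top).trans ?_)
  rw [lintegral_finsetSum _ fun j _ => by fun_prop]
  have h1 : ∀ j : Fin n, ∫⁻ x : Fin n → ℝ, ENNReal.ofReal (x j ^ 2)
      ∂(Measure.pi fun _ : Fin n => gaussianReal 0 Q) = Q := by
    intro j
    rw [← lintegral_sq_gaussianReal Q]
    exact (measurePreserving_eval (fun _ : Fin n => gaussianReal 0 Q) j).lintegral_comp
      (f := fun y => ENNReal.ofReal (y ^ 2)) (by fun_prop)
  simp_rw [h1]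
  rw [Finset.sum_const, Finset.card_univ, Fintype.card_fin, nsmul_eq_mul,
    ENNReal.div_le_iff hpos ENNReal.ofReal_ne_top, ← ENNReal.ofReal_mul (by positivity)]
  rw [← ENNReal.ofReal_natCast, ← ENNReal.ofReal_coe_nnreal, ← ENNReal.ofReal_mul hn0.le]
  refine ENNReal.ofReal_le_ofReal (le_of_eq ?_)
  field_simp

/-- White Gaussian words, conditioned on the power constraint. -/
theorem exists_truncated_gaussian (hn : 1 ≤ n) (Q : ℝ≥0) {P' : ℝ} (hP' : 0 < P')
    (hQ : Q < P') :
    ∃ (μ : Measure (Fin n → ℝ)) (C : ℝ≥0∞), IsProbabilityMeasure μ ∧ 1 ≤ C ∧ C ≠ ∞ ∧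
      C ≤ ENNReal.ofReal (1 - Q / P')⁻¹ ∧
      μ = C • (Measure.pi fun _ : Fin n => gaussianReal 0 Q).restrict (powerBall n P') ∧
      μ (powerBall n P')ᶜ = 0 := by
  set ν := Measure.pi fun _ : Fin n => gaussianReal 0 Q with hν
  have hfrac : Q / P' < 1 := (div_lt_one hP').2 hQ
  have hball : ENNReal.ofReal (1 - Q / P') ≤ ν (powerBall n P') := by
    have h := prob_add_prob_compl (μ := ν) (measurableSet_powerBall n P')
    have hc := pi_gaussian_compl_powerBall_le hn Q hP'
    rw [ENNReal.ofReal_sub _ (by positivity), ENNReal.ofReal_one, tsub_le_iff_right, ← h]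
    gcongr
  have hpos : 0 < ENNReal.ofReal (1 - Q / P') := ENNReal.ofReal_pos.2 (by linarith)
  have hne : ν (powerBall n P') ≠ 0 := (hpos.trans_le hball).ne'
  refine ⟨(ν (powerBall n P'))⁻¹ • ν.restrict (powerBall n P'), (ν (powerBall n P'))⁻¹, ?_, ?_,
    ?_, ?_, rfl, ?_⟩
  · exact cond_isProbabilityMeasure hne
  · exact ENNReal.one_le_inv.2 prob_le_one
  · exact ENNReal.inv_ne_top.2 hne
  · rw [ENNReal.ofReal_inv_of_pos (by linarith)]
    exact ENNReal.inv_le_inv.2 hball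
  · rw [Measure.smul_apply, Measure.restrict_apply (measurableSet_powerBall n P').compl]
    simp

/-- `r` collects the reference density and the normalization, neither of which sees the candidate;
hence maximizing information density is minimizing distance. -/
theorem infoDensity_eq {P : ℝ} (hP : 0 < P) (D : DelayVector K Dm) (y : Fin n → ℝ) :
    ∃ r : ℝ, ∀ x : Fin K → Fin n → ℝ,
      infoDensity P D x y = r - (∑ ℓ, (y ℓ - signal D x ℓ) ^ 2) / 2 := by
  refine ⟨∑ ℓ, (Real.log (√(2 * Real.pi * (1 : ℝ≥0)))⁻¹ - Real.log (gaussianPDFReal 0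
    (1 + (overlap n Finset.univ D ℓ : ℝ) * P).toNNReal (y ℓ))), fun x => ?_⟩
  rw [infoDensity, Finset.sum_div, ← Finset.sum_sub_distrib]
  refine Finset.sum_congr rfl fun ℓ _ => ?_
  have hv : (1 + (overlap n Finset.univ D ℓ : ℝ) * P).toNNReal ≠ 0 := by
    rw [Ne, Real.toNNReal_eq_zero, not_le]
    positivity
  rw [Real.log_div (gaussianPDFReal_pos _ _ _ one_ne_zero).ne' (gaussianPDFReal_pos _ _ _ hv).ne',
    gaussianPDFReal, Real.log_mul (by positivity) (Real.exp_pos _).ne', Real.log_exp]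
  simp only [NNReal.coe_one]
  ring

theorem measurable_infoDensity {P : ℝ} (D : DelayVector K Dm) (x : Fin K → Fin n → ℝ) :
    Measurable fun y : Fin n → ℝ => infoDensity P D x y := by
  unfold infoDensity
  refine Finset.measurable_sum _ fun ℓ _ => Real.measurable_log.comp ?_
  exact ((measurable_gaussianPDFReal _ _).comp (measurable_pi_apply ℓ)).div
    ((measurable_gaussianPDFReal _ _).comp (measurable_pi_apply ℓ))

/-- A finite family of measurable functions has a measurable choice of a maximizing index. -/
theorem exists_measurable_argmax {α ι : Type*} [MeasurableSpace α] [Finite ι] [Nonempty ι]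
    (f : ι → α → ℝ) (hf : ∀ i, Measurable (f i)) :
    ∃ g : α → ι, (∀ i, MeasurableSet {a | g a = i}) ∧ ∀ a i, f i a ≤ f (g a) a := by
  classical
  obtain ⟨N, ⟨e⟩⟩ := Finite.exists_equiv_fin ι
  set s : α → Finset (Fin N) := fun a =>
    Finset.univ.filter fun k => ∀ i, f i a ≤ f (e.symm k) a with hs
  have hne : ∀ a, (s a).Nonempty := by
    intro a
    obtain ⟨i, hi⟩ := Finite.exists_max fun i => f i a
    exact ⟨e i, by simpa [hs] using hi⟩
  have hmax : ∀ k, MeasurableSet {a | k ∈ s a} := by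
    intro k
    have : {a | k ∈ s a} = ⋂ i, {a | f i a ≤ f (e.symm k) a} := by
      ext a
      simp [hs]
    rw [this]
    exact MeasurableSet.iInter fun i => measurableSet_le (hf i) (hf _)
  refine ⟨fun a => e.symm ((s a).min' (hne a)), fun i => ?_, fun a i => ?_⟩
  -- Ties go to the least index, so the level sets are finite Boolean combinations of comparisons.
  · have : {a | e.symm ((s a).min' (hne a)) = i} =
        {a | e i ∈ s a} ∩ ⋂ k, ⋂ _ : k < e i, {a | k ∈ s a}ᶜ := by
      ext a
      simp only [Set.mem_ofPred_eq, Set.mem_inter_iff, Set.mem_iInter, Set.mem_compl_iff]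
      constructor
      · rintro rfl
        rw [Equiv.apply_symm_apply]
        exact ⟨Finset.min'_mem _ _, fun k hk hks => absurd (Finset.min'_le _ _ hks) (not_le.2 hk)⟩
      · rintro ⟨h1, h2⟩
        rw [Equiv.symm_apply_eq]
        exact le_antisymm (Finset.min'_le _ _ h1)
          (not_lt.1 fun h => h2 _ h (Finset.min'_mem _ _))
    rw [this]
    exact (hmax _).inter (MeasurableSet.iInter fun k => MeasurableSet.iInter fun _ =>
      (hmax k).compl)
  · have := Finset.min'_mem _ (hne a)
    simp only [hs, Finset.mem_filter, Finset.mem_univ, true_and] at this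
    exact this i

theorem exists_code {P P' : ℝ} (hKM : K ≤ M) (c : Fin M → Fin n → ℝ)
    (hc : ∀ m, c m ∈ powerBall n P') :
    ∃ code : Code n M K Dm P P', code.encode = c := by
  classical
  have hne : Nonempty {m : Fin K → Fin M // Function.Injective m} :=
    ⟨⟨Fin.castLE hKM, Fin.castLE_injective hKM⟩⟩
  have h : ∀ D : DelayVector K Dm, ∃ g : (Fin n → ℝ) → {m : Fin K → Fin M // Function.Injective m},
      (∀ i, MeasurableSet {a | g a = i}) ∧ ∀ y (i : {m : Fin K → Fin M // Function.Injective m}),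
        infoDensity P D (fun k => c (i.1 k)) y ≤
        infoDensity P D (fun k => c ((g y).1 k)) y := fun D =>
    exists_measurable_argmax _ fun _ => measurable_infoDensity D _
  choose g hg hmax using h
  refine ⟨⟨c, hc, fun D y => Finset.univ.image (g D y).1, fun D s => ?_, fun D y =>
    ⟨(g D y).1, (g D y).2, rfl, fun m' hm' => hmax D y ⟨m', hm'⟩⟩⟩, rfl⟩
  have : {y | Finset.univ.image (g D y).1 = s} =
      ⋃ i : {m : Fin K → Fin M // Function.Injective m}, ⋃ _ : Finset.univ.image i.1 = s,
        {y | g D y = i} := by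
    ext y
    simp
  rw [this]
  exact MeasurableSet.iUnion fun i => MeasurableSet.iUnion fun _ => hg D i

end Codes

/-! ### From the loss probability of a codebook to the per-user error. -/

section PerUserError

variable {n M K Dm : ℕ}

/-- Independent messages, uniform on the message set. -/
noncomputable abbrev messageLaw (M K : ℕ) : Measure (Fin K → Fin M) :=
  Measure.pi fun _ : Fin K => uniformOn (Set.univ : Set (Fin M))

theorem uniformOn_univ_singleton (a : Fin M) :
    uniformOn (Set.univ : Set (Fin M)) {a} = (M : ℝ≥0∞)⁻¹ := by
  rw [uniformOn_univ]
  simp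

theorem messageLaw_singleton (m : Fin K → Fin M) :
    messageLaw M K {m} = ((M : ℝ≥0∞)⁻¹) ^ K := by
  rw [messageLaw, Measure.pi_singleton]
  simp [uniformOn_univ_singleton]

theorem isProbabilityMeasure_uniformOn_fin (hM : 1 ≤ M) :
    IsProbabilityMeasure (uniformOn (Set.univ : Set (Fin M))) := by
  have : Nonempty (Fin M) := ⟨⟨0, hM⟩⟩
  exact isProbabilityMeasure_uniformOn Set.finite_univ Set.univ_nonempty

theorem messageLaw_eq_le (hM : 1 ≤ M) {i j : Fin K} (hij : i ≠ j) :
    messageLaw M K {m | m i = m j} ≤ (M : ℝ≥0∞)⁻¹ := by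
  classical
  have := isProbabilityMeasure_uniformOn_fin hM
  have hsub : {m : Fin K → Fin M | m i = m j} ⊆ ⋃ a ∈ (Finset.univ : Finset (Fin M)),
      Set.univ.pi fun k => if k ∈ ({i, j} : Finset (Fin K)) then {a} else Set.univ := by
    intro m hm
    simp only [Set.mem_iUnion]
    refine ⟨m i, Finset.mem_univ _, fun k _ => ?_⟩
    simp only [Finset.mem_insert, Finset.mem_singleton]
    split_ifs with h
    · rcases h with rfl | rfl
      · rfl
      · exact hm.symm
    · trivial
  have hpi : ∀ a : Fin M, messageLaw M K (Set.univ.pi fun k =>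
      if k ∈ ({i, j} : Finset (Fin K)) then {a} else Set.univ) = ((M : ℝ≥0∞)⁻¹) ^ 2 := by
    intro a
    rw [messageLaw, Measure.pi_pi]
    have : ∀ k, uniformOn (Set.univ : Set (Fin M))
        (if k ∈ ({i, j} : Finset (Fin K)) then {a} else Set.univ) =
        if k ∈ ({i, j} : Finset (Fin K)) then (M : ℝ≥0∞)⁻¹ else 1 := by
      intro k
      split_ifs
      · exact uniformOn_univ_singleton a
      · exact measure_univ
    simp_rw [this]
    rw [Finset.prod_ite_mem, Finset.univ_inter, Finset.prod_const, Finset.card_pair hij]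
  refine (measure_mono hsub).trans ((measure_biUnion_finset_le _ _).trans ?_)
  simp_rw [hpi]
  have hM0 : (M : ℝ≥0∞) ≠ 0 := by
    simp only [ne_eq, Nat.cast_eq_zero]
    omega
  rw [Finset.sum_const, Finset.card_univ, Fintype.card_fin, nsmul_eq_mul, sq, ← mul_assoc,
    ENNReal.mul_inv_cancel hM0 (ENNReal.natCast_ne_top M), one_mul]

theorem messageLaw_collision_le (hM : 1 ≤ M) :
    messageLaw M K {m | ¬Function.Injective m} ≤
      ENNReal.ofReal ((K : ℝ) * (K - 1) / (2 * M)) := by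
  have hsub : {m : Fin K → Fin M | ¬Function.Injective m} ⊆
      ⋃ j ∈ (Finset.univ : Finset (Fin K)), ⋃ i ∈ Finset.Iio j, {m | m i = m j} := by
    intro m hm
    simp only [Set.mem_iUnion]
    rw [Set.mem_ofPred_eq, Function.Injective] at hm
    push Not at hm
    obtain ⟨i, j, h, hne⟩ := hm
    rcases lt_or_gt_of_ne hne with hlt | hlt
    · exact ⟨j, Finset.mem_univ _, i, Finset.mem_Iio.2 hlt, h⟩
    · exact ⟨i, Finset.mem_univ _, j, Finset.mem_Iio.2 hlt, h.symm⟩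
  have hj : ∀ j : Fin K, messageLaw M K (⋃ i ∈ Finset.Iio j, {m | m i = m j}) ≤
      ((j : ℕ) : ℝ≥0∞) * (M : ℝ≥0∞)⁻¹ := by
    intro j
    refine (measure_biUnion_finset_le _ _).trans ?_
    refine (Finset.sum_le_card_nsmul _ _ (M : ℝ≥0∞)⁻¹ fun i hi =>
      messageLaw_eq_le hM (Finset.mem_Iio.1 hi).ne).trans (le_of_eq ?_)
    rw [Fin.card_Iio, nsmul_eq_mul]
  refine (measure_mono hsub).trans ((measure_biUnion_finset_le _ _).trans
    ((Finset.sum_le_sum fun j _ => hj j).trans ?_))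
  rw [← Finset.sum_mul, ← Nat.cast_sum, Fin.sum_univ_eq_sum_range (fun i => i) K,
    ← ENNReal.ofReal_natCast, ← ENNReal.ofReal_natCast M,
    ← ENNReal.ofReal_inv_of_pos (by exact_mod_cast hM), ← ENNReal.ofReal_mul (by positivity)]
  refine ENNReal.ofReal_le_ofReal (le_of_eq ?_)
  have h2 : ((∑ i ∈ Finset.range K, i : ℕ) : ℝ) * 2 = K * (K - 1) := by
    rcases Nat.eq_zero_or_pos K with rfl | hK
    · simp
    · have := Finset.sum_range_id_mul_two K
      have h3 : (((∑ i ∈ Finset.range K, i) * 2 : ℕ) : ℝ) = ((K * (K - 1) : ℕ) : ℝ) := by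
        rw [this]
      push_cast [Nat.cast_sub hK] at h3 ⊢
      exact h3
  have hM0 : (M : ℝ) ≠ 0 := by
    have : (0 : ℝ) < M := by exact_mod_cast hM
    exact this.ne'
  rw [← h2]
  field_simp

/-- The noise realizations for which minimum distance decoding of the codebook `c` loses one of
the messages `m`. -/
def lossEvent (D : DelayVector K Dm) (c : Fin M → Fin n → ℝ) (m : Fin K → Fin M) :
    Set (Fin n → ℝ) := {z | (c, z) ∈ ⋃ m' ∈ wrongTuples m, confusion n D m m'}

open Classical in
/-- The average over tuples of distinct messages of the probability that minimum distance decoding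
loses a message. -/
noncomputable def averageLoss (D : DelayVector K Dm) (c : Fin M → Fin n → ℝ) : ℝ≥0∞ :=
  ((M : ℝ≥0∞)⁻¹) ^ K * ∑ m ∈ Finset.univ.filter fun m : Fin K → Fin M => Function.Injective m,
    (Measure.pi fun _ : Fin n => gaussianReal 0 1) (lossEvent D c m)

/-- The loss of any message is charged to every user; the factor lost, at most `K`, is covered by
the exponential gain. Power violations cannot occur, as every codeword satisfies the constraint. -/
theorem law_errorEvent_le {P P' : ℝ} (hP : 0 < P) (hM : 1 ≤ M) (code : Code n M K Dm P P')
    (D : DelayVector K Dm) (i : Fin K) :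
    law n M K (code.errorEvent D i) ≤
      ENNReal.ofReal ((K : ℝ) * (K - 1) / (2 * M)) + averageLoss D code.encode := by
  classical
  have := isProbabilityMeasure_uniformOn_fin hM
  have hsub : code.errorEvent D i ⊆ ({m | ¬Function.Injective m} ×ˢ Set.univ) ∪
      ⋃ m ∈ Finset.univ.filter fun m : Fin K → Fin M => Function.Injective m,
        ({m} ×ˢ lossEvent D code.encode m) := by
    rintro ⟨m, z⟩ hω
    by_cases hm : Function.Injective m
    · right
      simp only [Set.mem_iUnion]
      refine ⟨m, by simpa using hm, rfl, ?_⟩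
      rcases hω with ⟨l, hl, h⟩ | h | h
      · exact absurd (hm h).symm hl
      · obtain ⟨m', hm', hdec, hmax⟩ :=
          code.maximal D (received D (fun k => code.encode (m k)) z)
        simp only [] at h
        rw [hdec] at h
        simp only [lossEvent, Set.mem_ofPred_eq, Set.mem_iUnion]
        refine ⟨m', ?_, ?_⟩
        · simp only [wrongTuples, Finset.mem_filter, Finset.mem_univ, true_and]
          exact ⟨hm', i, by simpa using h⟩
        -- The sent tuple is itself an admissible competitor of the decoded one.
        · have h1 := hmax m hm
          obtain ⟨r, hr⟩ := infoDensity_eq hP D (received D (fun k => code.encode (m k)) z)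
          rw [hr, hr] at h1
          have h2 : ∑ ℓ, (received D (fun k => code.encode (m k)) z ℓ -
              signal D (fun k => code.encode (m k)) ℓ) ^ 2 = ∑ ℓ, z ℓ ^ 2 := by
            refine Finset.sum_congr rfl fun ℓ _ => ?_
            rw [received, add_sub_cancel_left]
          have h3 : ∑ ℓ, (received D (fun k => code.encode (m k)) z ℓ -
              signal D (fun k => code.encode (m' k)) ℓ) ^ 2 =
              ∑ ℓ, (z ℓ + signal D (fun k => code.encode (m k)) ℓ -
                signal D (fun k => code.encode (m' k)) ℓ) ^ 2 := by
            refine Finset.sum_congr rfl fun ℓ _ => ?_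
            rw [received, add_comm (z ℓ)]
          rw [h2, h3] at h1
          rw [confusion, Set.mem_ofPred_eq]
          dsimp only
          linarith
      · exact absurd (code.power (m i)) (not_le.2 h)
    · exact Or.inl ⟨hm, trivial⟩
  refine (measure_mono hsub).trans ((measure_union_le _ _).trans (add_le_add ?_ ?_))
  · rw [law, Measure.prod_prod, measure_univ, mul_one]
    exact messageLaw_collision_le hM
  · refine (measure_biUnion_finset_le _ _).trans ?_
    rw [averageLoss, Finset.mul_sum]
    refine Finset.sum_le_sum fun m _ => le_of_eq ?_
    rw [law, Measure.prod_prod]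
    exact congrArg (· * _) (messageLaw_singleton m)

theorem pupe_le {P P' : ℝ} (hP : 0 < P) (hM : 1 ≤ M) (code : Code n M K Dm P P')
    (D : DelayVector K Dm) {b : ℝ} (hb : 0 ≤ b)
    (h : averageLoss D code.encode ≤ ENNReal.ofReal b) :
    code.pupe D ≤ (K : ℝ) * (K - 1) / (2 * M) + b := by
  have hcoll : 0 ≤ (K : ℝ) * (K - 1) / (2 * M) := by
    rcases Nat.eq_zero_or_pos K with rfl | hK
    · simp
    · have : (1 : ℝ) ≤ K := by exact_mod_cast hK
      exact div_nonneg (mul_nonneg (by linarith) (by linarith)) (by positivity)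
  have h1 : ∀ i, (law n M K).real (code.errorEvent D i) ≤ (K : ℝ) * (K - 1) / (2 * M) + b := by
    intro i
    refine ENNReal.toReal_le_of_le_ofReal (by positivity) ?_
    rw [ENNReal.ofReal_add hcoll hb]
    exact (law_errorEvent_le hP hM code D i).trans (add_le_add le_rfl h)
  rw [Code.pupe]
  refine (mul_le_mul_of_nonneg_left (Finset.sum_le_card_nsmul Finset.univ _ _ fun i _ => h1 i)
    (by positivity)).trans ?_
  rw [Finset.card_univ, Fintype.card_fin, nsmul_eq_mul, ← mul_assoc]
  refine mul_le_of_le_one_left (by positivity) ?_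
  rcases Nat.eq_zero_or_pos K with rfl | hK
  · simp
  · rw [one_div_mul_cancel]
    positivity

theorem pupe_le_one {P P' : ℝ} (hM : 1 ≤ M) (code : Code n M K Dm P P')
    (D : DelayVector K Dm) : code.pupe D ≤ 1 := by
  have := isProbabilityMeasure_uniformOn_fin hM
  have : IsProbabilityMeasure (law n M K) := by
    unfold law
    infer_instance
  rw [Code.pupe]
  refine (mul_le_mul_of_nonneg_left (Finset.sum_le_card_nsmul Finset.univ _ 1 fun i _ =>
    measureReal_le_one) (by positivity)).trans ?_
  rw [Finset.card_univ, Fintype.card_fin, nsmul_eq_mul, mul_one]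
  rcases Nat.eq_zero_or_pos K with rfl | hK
  · simp
  · rw [one_div_mul_cancel]
    positivity

end PerUserError

/-! ### One codebook for all delay vectors. -/

section Existence

variable {n M K Dm : ℕ}

theorem DelayVector.toFin_injective (K Dm : ℕ) : Function.Injective
    fun (D : DelayVector K Dm) (i : Fin K) =>
      (⟨D.d i, Nat.lt_succ_of_le (D.le_max i)⟩ : Fin (Dm + 1)) := by
  rintro ⟨d, _, _, _⟩ ⟨d', _, _, _⟩ h
  have : d = d' := by
    funext i
    exact congrArg Fin.val (congrFun h i)
  subst this
  rfl

noncomputable instance (K Dm : ℕ) : Fintype (DelayVector K Dm) :=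
  Fintype.ofInjective _ (DelayVector.toFin_injective K Dm)

/-- For fixed `K` this is polynomial in `n`, so a sum over all delays is affordable. -/
theorem DelayVector.card_le (K Dm : ℕ) : Fintype.card (DelayVector K Dm) ≤ (Dm + 1) ^ K := by
  simpa using Fintype.card_le_of_injective _ (DelayVector.toFin_injective K Dm)

theorem measurable_averageLoss (D : DelayVector K Dm) :
    Measurable fun c : Fin M → Fin n → ℝ => averageLoss D c := by
  unfold averageLoss
  refine Measurable.const_mul (Finset.measurable_sum _ fun m _ => ?_) _
  exact measurable_measure_prodMk_left
    (Finset.measurableSet_biUnion _ fun m' _ => measurableSet_confusion D m m')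

theorem lintegral_averageLoss_le (μ : Measure (Fin n → ℝ)) [IsProbabilityMeasure μ]
    (D : DelayVector K Dm) (hM : 1 ≤ M) (b : ℝ≥0∞)
    (hb : ∀ m : Fin K → Fin M, Function.Injective m →
      ((Measure.pi fun _ : Fin M => μ).prod (Measure.pi fun _ : Fin n => gaussianReal 0 1))
        (⋃ m' ∈ wrongTuples m, confusion n D m m') ≤ b) :
    ∫⁻ c, averageLoss D c ∂(Measure.pi fun _ : Fin M => μ) ≤ b := by
  classical
  have hset : ∀ m : Fin K → Fin M, MeasurableSet (⋃ m' ∈ wrongTuples m, confusion n D m m') :=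
    fun m => Finset.measurableSet_biUnion _ fun m' _ => measurableSet_confusion D m m'
  have hmeas : ∀ m : Fin K → Fin M, Measurable fun c : Fin M → Fin n → ℝ =>
      (Measure.pi fun _ : Fin n => gaussianReal 0 1) (lossEvent D c m) := fun m =>
    measurable_measure_prodMk_left (hset m)
  unfold averageLoss
  rw [lintegral_const_mul _ (Finset.measurable_sum _ fun m _ => hmeas m),
    lintegral_finsetSum _ fun m _ => hmeas m]
  have h1 : ∀ m ∈ Finset.univ.filter fun m : Fin K → Fin M => Function.Injective m,
      ∫⁻ c, (Measure.pi fun _ : Fin n => gaussianReal 0 1) (lossEvent D c m)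
        ∂(Measure.pi fun _ : Fin M => μ) ≤ b := by
    intro m hm
    refine le_trans (le_of_eq ?_) (hb m (by simpa using hm))
    rw [Measure.prod_apply (hset m)]
    rfl
  refine (mul_le_mul' le_rfl (Finset.sum_le_card_nsmul _ _ _ h1)).trans ?_
  rw [nsmul_eq_mul, ← mul_assoc]
  refine mul_le_of_le_one_left zero_le ?_
  have hcard : ((Finset.univ.filter fun m : Fin K → Fin M => Function.Injective m).card : ℝ≥0∞) ≤
      (M : ℝ≥0∞) ^ K := by
    have : (Finset.univ.filter fun m : Fin K → Fin M => Function.Injective m).card ≤ M ^ K := by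
      simpa using Finset.card_le_univ
        (Finset.univ.filter fun m : Fin K → Fin M => Function.Injective m)
    exact_mod_cast this
  have hM0 : (M : ℝ≥0∞) ≠ 0 := by
    simp only [ne_eq, Nat.cast_eq_zero]
    omega
  refine (mul_le_mul' le_rfl hcard).trans (le_of_eq ?_)
  rw [← mul_pow, ENNReal.inv_mul_cancel hM0 (ENNReal.natCast_ne_top M), one_pow]

/-- One codebook is good for all delay vectors: the constant does not depend on `n` and `M`. -/
theorem exists_codebook (hn : 1 ≤ n) (hM : 1 ≤ M) (hDm : Dm ≤ n) {P P' : ℝ} (hP : 0 < P)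
    (Q : ℝ≥0) (hPQ : P ≤ Q) (hQ : Q < P') (t : ℕ → ℕ → ℝ)
    (ht : ∀ T : Finset (Fin K), T.Nonempty → t (iota T) T.card ∈ Set.Ioo 0 1)
    (ε : ℝ) (hε : ∀ T : Finset (Fin K), T.Nonempty →
      g₁ M P T.card (worst n Dm (iota T) T.card) (t (iota T) T.card) *
        Real.exp (-(powerGain P Q * t (iota T) T.card * (n - Dm))) ≤ ε) :
    ∃ c : Fin M → Fin n → ℝ, (∀ m, c m ∈ powerBall n P') ∧ ∀ D : DelayVector K Dm,
      averageLoss D c ≤ ENNReal.ofReal (((n : ℝ) + 1) ^ K *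
        (Fintype.card (Finset (Fin K) × (Fin K → Fin K)) *
          ((1 - Q / P')⁻¹ ^ (2 * K) * ε))) := by
  have hP' : 0 < P' := (hP.trans_le hPQ).trans hQ
  obtain ⟨μ, C, hμp, hC1, hC, hC0, hμ, hball⟩ := exists_truncated_gaussian hn Q hP' hQ
  have hfrac : 0 < 1 - Q / P' := by
    have := (div_lt_one hP').2 hQ
    linarith
  set b : ℝ≥0∞ := Fintype.card (Finset (Fin K) × (Fin K → Fin K)) *
    (C ^ (2 * K) * ENNReal.ofReal ε) with hb
  have hint : ∫⁻ c, ∑ D : DelayVector K Dm, averageLoss D c ∂(Measure.pi fun _ : Fin M => μ) ≤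
      ((Dm + 1 : ℕ) : ℝ≥0∞) ^ K * b := by
    rw [lintegral_finsetSum _ fun D _ => measurable_averageLoss D]
    refine (Finset.sum_le_card_nsmul _ _ b fun D _ => lintegral_averageLoss_le μ D hM b
      fun m hm => measure_wrongTuples_le μ (powerBall n P') Q C hC1 hC hμ D hDm hP hPQ t ht ε hε
        m hm).trans ?_
    rw [nsmul_eq_mul, Finset.card_univ]
    refine mul_le_mul' ?_ le_rfl
    exact_mod_cast DelayVector.card_le K Dm
  have hnull : (Measure.pi fun _ : Fin M => μ) {c | ∃ m, c m ∉ powerBall n P'} = 0 := by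
    have : {c : Fin M → Fin n → ℝ | ∃ m, c m ∉ powerBall n P'} =
        ⋃ m, Function.eval m ⁻¹' (powerBall n P')ᶜ := by
      ext c
      simp
    rw [this]
    exact measure_iUnion_null fun m => Measure.pi_eval_preimage_null _ hball
  -- Some codebook outside the null set of power violations has total loss, over all delays, at most
  -- the mean; being nonnegative, each single loss is then below it too.
  obtain ⟨c, hc, hle⟩ := exists_notMem_null_le_lintegral (μ := Measure.pi fun _ : Fin M => μ)
    (Finset.measurable_sum Finset.univ fun (D : DelayVector K Dm) _ =>
      measurable_averageLoss D).aemeasurable hnull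
  refine ⟨c, by simpa using hc, fun D => ?_⟩
  refine (Finset.single_le_sum (f := fun D => averageLoss D c) (fun _ _ => zero_le)
    (Finset.mem_univ D)).trans (hle.trans (hint.trans ?_))
  rw [ENNReal.ofReal_mul (by positivity), ENNReal.ofReal_mul (by positivity),
    ENNReal.ofReal_mul (by positivity), ENNReal.ofReal_natCast,
    ENNReal.ofReal_pow (by positivity), ENNReal.ofReal_pow (by positivity)]
  refine mul_le_mul' ?_ (mul_le_mul' le_rfl (mul_le_mul' ?_ le_rfl))
  · gcongr
    rw [← ENNReal.ofReal_natCast]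
    refine ENNReal.ofReal_le_ofReal ?_
    push_cast
    have : (Dm : ℝ) ≤ n := by exact_mod_cast hDm
    linarith
  · gcongr

end Existence

/-! ### Derivatives of `E` and lower bounds at the saddlepoint. -/

section Derivatives

variable {n : ℕ}

theorem hasDerivAt_log_one_sub {x t : ℝ} (hx : 0 ≤ x) (ht : t ^ 2 < 1) :
    HasDerivAt (fun t => t * Real.log (1 + x) + Real.log (1 - x * t ^ 2 / (1 + x)))
      (Real.log (1 + x) - 2 * (x * t / (1 + x - x * t ^ 2))) t := by
  have hx1 : 0 < 1 + x := by linarith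
  have hd : 0 < 1 + x - x * t ^ 2 := by nlinarith
  have he : 1 - x * t ^ 2 / (1 + x) = (1 + x - x * t ^ 2) / (1 + x) := by
    field_simp
  have hne : 1 - x * t ^ 2 / (1 + x) ≠ 0 := by
    rw [he]
    positivity
  have h1 : HasDerivAt (fun t => 1 - x * t ^ 2 / (1 + x)) (-(x * (2 * t) / (1 + x))) t := by
    have := (((hasDerivAt_pow 2 t).const_mul x).div_const (1 + x)).const_sub 1
    simpa using this
  have h2 := ((hasDerivAt_id t).mul_const (Real.log (1 + x))).add (h1.log hne)
  refine h2.congr_deriv ?_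
  rw [he]
  field_simp
  ring

theorem hasDerivAt_E {P : ℝ} (hP : 0 ≤ P) (a : Fin n → ℕ) {t : ℝ} (ht : t ^ 2 < 1) :
    HasDerivAt (E P a) (1 / 2 * ∑ i, (Real.log (1 + a i * P) -
      2 * (a i * P * t / (1 + a i * P - a i * P * t ^ 2)))) t := by
  unfold E
  exact (HasDerivAt.fun_sum fun i _ => hasDerivAt_log_one_sub (by positivity) ht).const_mul _

theorem E₁_eq {P : ℝ} (hP : 0 ≤ P) (a : Fin n → ℕ) {t : ℝ} (ht : t ^ 2 < 1) :
    E₁ P a t = 1 / 2 * ∑ i, (Real.log (1 + a i * P) -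
      2 * (a i * P * t / (1 + a i * P - a i * P * t ^ 2))) :=
  (hasDerivAt_E hP a ht).deriv

theorem hasDerivAt_tilt {x t : ℝ} (hx : 0 ≤ x) (ht : t ^ 2 < 1) :
    HasDerivAt (fun t => x * t / (1 + x - x * t ^ 2))
      (x * (1 + x + x * t ^ 2) / (1 + x - x * t ^ 2) ^ 2) t := by
  have hd : 0 < 1 + x - x * t ^ 2 := by nlinarith
  have h1 : HasDerivAt (fun t => x * t) (x * 1) t := (hasDerivAt_id t).const_mul x
  have h2 : HasDerivAt (fun t => 1 + x - x * t ^ 2) (-(x * (2 * t))) t := by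
    have := ((hasDerivAt_pow 2 t).const_mul x).const_sub (1 + x)
    simpa using this
  refine (h1.div h2 hd.ne').congr_deriv ?_
  congr 1
  ring

theorem E₂_eq {P : ℝ} (hP : 0 ≤ P) (a : Fin n → ℕ) {t : ℝ} (ht : t ^ 2 < 1) :
    -E₂ P a t = ∑ i, a i * P * (1 + a i * P + a i * P * t ^ 2) /
      (1 + a i * P - a i * P * t ^ 2) ^ 2 := by
  have h1 : deriv (E P a) =ᶠ[nhds t] fun t => 1 / 2 * ∑ i, (Real.log (1 + a i * P) -
      2 * (a i * P * t / (1 + a i * P - a i * P * t ^ 2))) := by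
    have hopen : IsOpen {t : ℝ | t ^ 2 < 1} := isOpen_lt (by fun_prop) (by fun_prop)
    filter_upwards [hopen.mem_nhds ht] with u hu
    exact (hasDerivAt_E hP a hu).deriv
  have h2 : HasDerivAt (fun t => 1 / 2 * ∑ i, (Real.log (1 + a i * P) -
      2 * (a i * P * t / (1 + a i * P - a i * P * t ^ 2))))
      (1 / 2 * ∑ i, -(2 * (a i * P * (1 + a i * P + a i * P * t ^ 2) /
        (1 + a i * P - a i * P * t ^ 2) ^ 2))) t :=
    (HasDerivAt.fun_sum fun i _ =>
      ((hasDerivAt_tilt (by positivity) ht).const_mul 2).const_sub _).const_mul _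
  rw [E₂, iteratedDeriv_succ, iteratedDeriv_one, h1.deriv_eq, h2.deriv, Finset.sum_neg_distrib,
    ← Finset.mul_sum]
  ring

theorem neg_E₂_pos {P : ℝ} (hP : 0 < P) (a : Fin n → ℕ) (ha : ∃ i, 1 ≤ a i) {t : ℝ}
    (ht : t ^ 2 < 1) : 0 < -E₂ P a t := by
  rw [E₂_eq hP.le a ht]
  have hd : ∀ i, 0 < 1 + a i * P - a i * P * t ^ 2 := fun i => by
    have : 0 ≤ a i * P := by positivity
    nlinarith
  obtain ⟨i, hi⟩ := ha
  have hi' : (0 : ℝ) < a i := by exact_mod_cast hi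
  refine Finset.sum_pos' (fun j _ => ?_) ⟨i, Finset.mem_univ _, ?_⟩
  · have := hd j
    positivity
  · have := hd i
    positivity

theorem neg_E₂_le {P : ℝ} (hP : 0 < P) (K : ℕ) (a : Fin n → ℕ) (ha : ∀ i, a i ≤ K) {t : ℝ}
    (ht : t ^ 2 < 1) : -E₂ P a t ≤ n * (2 * (1 + K * P) ^ 2) := by
  rw [E₂_eq hP.le a ht]
  refine (Finset.sum_le_card_nsmul _ _ (2 * (1 + K * P) ^ 2) fun i _ => ?_).trans (by simp)
  have hx : (a i : ℝ) * P ≤ K * P := by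
    have : (a i : ℝ) ≤ K := by exact_mod_cast ha i
    gcongr
  have hx0 : 0 ≤ (a i : ℝ) * P := by positivity
  set x := (a i : ℝ) * P
  have hd : 1 ≤ 1 + x - x * t ^ 2 := by nlinarith
  have h1 : 1 ≤ (1 + x - x * t ^ 2) ^ 2 := one_le_pow₀ hd
  refine (div_le_self (by positivity) h1).trans ?_
  have h2 : x * (1 + x + x * t ^ 2) ≤ 2 * (1 + x) ^ 2 := by
    nlinarith [mul_nonneg hx0 hx0]
  refine h2.trans ?_
  gcongr

/-- At a saddlepoint `log g₁ = t E₁ - E`, where the terms `t log (1 + a_i P)` cancel and only terms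
of order `t²` remain. So `g₁` stays bounded below while `t` is of order `1/√n`. -/
theorem exp_le_g₁ {P : ℝ} (hP : 0 < P) (K M s : ℕ) (a : Fin n → ℕ) (ha : ∀ i, a i ≤ K) {t : ℝ}
    (ht : IsSaddle M P s a t) : Real.exp (-(n * (K * P) * t ^ 2)) ≤ g₁ M P s a t := by
  obtain ⟨⟨ht0, ht1⟩, hs⟩ := ht
  have ht2 : t ^ 2 < 1 := by nlinarith
  rw [g₁, Real.exp_le_exp, mul_assoc t, ← hs, E₁_eq hP.le a ht2, E]
  have h1 : t * (1 / 2 * ∑ i, (Real.log (1 + a i * P) -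
      2 * (a i * P * t / (1 + a i * P - a i * P * t ^ 2)))) -
      1 / 2 * ∑ i, (t * Real.log (1 + a i * P) +
        Real.log (1 - a i * P * t ^ 2 / (1 + a i * P))) =
      ∑ i, (-(a i * P * t ^ 2 / (1 + a i * P - a i * P * t ^ 2)) -
        1 / 2 * Real.log (1 - a i * P * t ^ 2 / (1 + a i * P))) := by
    rw [← mul_assoc, Finset.mul_sum, Finset.mul_sum, ← Finset.sum_sub_distrib]
    refine Finset.sum_congr rfl fun i _ => by ring
  rw [h1]
  have h2 : -(n * (K * P) * t ^ 2) = ∑ _i : Fin n, -(K * P * t ^ 2) := by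
    rw [Finset.sum_const, Finset.card_univ, Fintype.card_fin, nsmul_eq_mul]
    ring
  rw [h2]
  refine Finset.sum_le_sum fun i _ => ?_
  have hx : (a i : ℝ) * P ≤ K * P := by
    have : (a i : ℝ) ≤ K := by exact_mod_cast ha i
    gcongr
  have hx0 : 0 ≤ (a i : ℝ) * P := by positivity
  set x := (a i : ℝ) * P
  have hd : 1 ≤ 1 + x - x * t ^ 2 := by nlinarith
  have h3 : Real.log (1 - x * t ^ 2 / (1 + x)) ≤ 0 := by
    refine Real.log_nonpos ?_ ?_
    · rw [sub_nonneg, div_le_one (by linarith)]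
      nlinarith
    · have : 0 ≤ x * t ^ 2 / (1 + x) := by positivity
      linarith
  have h4 : x * t ^ 2 / (1 + x - x * t ^ 2) ≤ K * P * t ^ 2 :=
    (div_le_self (by positivity) hd).trans (by gcongr)
  linarith

end Derivatives

/-! ### Lower bounds for the explicit bound. -/

section MainBound

variable {n M K Dm : ℕ}

theorem iota_le_one (T : Finset (Fin K)) : iota T ≤ 1 := by
  unfold iota
  split_ifs <;> simp

/-- The auxiliary points are known to lie in `(0,1)` only at pairs `(iota T, T.card)`. The pair `(0,
K)` is not of this kind, but its binomial coefficient vanishes. -/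
theorem exists_iota_zero {s : ℕ} (hs : s + 1 ≤ K) :
    ∃ T : Finset (Fin K), iota T = 0 ∧ T.card = s := by
  refine ⟨(Finset.univ : Finset (Fin s)).map
    (⟨fun i => ⟨(i : ℕ) + 1, by have := i.isLt; omega⟩, fun i j h => by
      simpa [Fin.ext_iff] using h⟩ : Fin s ↪ Fin K), ?_, by simp⟩
  unfold iota
  rw [if_neg]
  simp

theorem exists_iota_one {s : ℕ} (hs1 : 1 ≤ s) (hs : s ≤ K) :
    ∃ T : Finset (Fin K), iota T = 1 ∧ T.card = s := by
  refine ⟨(Finset.univ : Finset (Fin s)).map (Fin.castLEEmb hs), ?_, by simp⟩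
  unfold iota
  rw [if_pos]
  exact ⟨⟨0, by omega⟩, by simpa using ⟨⟨0, by omega⟩, rfl⟩, rfl⟩

theorem card_lt_of_iota_eq_zero (hK : 1 ≤ K) (T : Finset (Fin K)) (hT : iota T = 0) :
    T.card ≤ K - 1 := by
  have h0 : (⟨0, hK⟩ : Fin K) ∉ T := by
    intro h
    unfold iota at hT
    rw [if_pos ⟨_, h, rfl⟩] at hT
    exact one_ne_zero hT
  have h1 : T ⊆ Finset.univ.erase ⟨0, hK⟩ := fun i hi =>
    Finset.mem_erase.2 ⟨fun h => h0 (h ▸ hi), Finset.mem_univ _⟩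
  simpa using Finset.card_le_card h1

/-- The worst-case delays: everyone but the first user is maximally late. -/
def worstDelay (K Dm : ℕ) : DelayVector K Dm where
  d i := if (i : ℕ) = 0 then 0 else Dm
  first i hi := if_pos hi
  mono i j hij := by
    dsimp only
    split_ifs with h1 h2 h2
    · exact le_rfl
    · exact Nat.zero_le _
    · exact absurd (le_antisymm (h2 ▸ Fin.le_def.1 hij) (Nat.zero_le _)) h1
    · exact le_rfl
  le_max i := by
    split_ifs
    · exact Nat.zero_le _
    · exact le_rfl

/-- The worst profile is attained, so the saddlepoint hypothesis at this delay vector yields `tl ≤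
t₀`. -/
theorem overlap_worstDelay (S : Finset (Fin K)) :
    overlap n S (worstDelay K Dm) = worst n Dm (iota S) S.card := by
  funext ℓ
  refine le_antisymm ?_ (worst_le_overlap (worstDelay K Dm) S _ le_rfl ℓ)
  unfold overlap worst
  split_ifs with h
  · unfold iota
    split_ifs with hex
    · refine Finset.card_le_one.2 fun i hi j hj => ?_
      have key : ∀ k : Fin K, (worstDelay K Dm).d k ≤ (ℓ : ℕ) → (k : ℕ) = 0 := by
        intro k hk
        by_contra h0
        have hd : (worstDelay K Dm).d k = Dm := if_neg h0
        omega
      have hi0 := key i (Finset.mem_filter.1 hi).2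
      have hj0 := key j (Finset.mem_filter.1 hj).2
      exact Fin.ext (hi0.trans hj0.symm)
    · rw [Nat.le_zero, Finset.card_eq_zero, Finset.filter_eq_empty_iff]
      intro i hi
      have h0 : (i : ℕ) ≠ 0 := fun h0 => hex ⟨i, hi, h0⟩
      have hd : (worstDelay K Dm).d i = Dm := if_neg h0
      omega
  · exact Finset.card_filter_le _ _

theorem worst_le {ι s : ℕ} (hι : ι ≤ K) (hs : s ≤ K) (ℓ : Fin n) : worst n Dm ι s ℓ ≤ K := by
  unfold worst
  split_ifs
  · exact hι
  · exact hs

theorem term_nonneg (P : ℝ) (ι s : ℕ) {t₀ tl tu : ℝ} (hl : tl ∈ Set.Ioo (0 : ℝ) 1)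
    (hu : tu ∈ Set.Ioo (0 : ℝ) 1) : 0 ≤ term n M Dm P ι s t₀ tl tu := by
  have h1 : 0 ≤ tl - tl ^ 2 := by nlinarith [hl.1, hl.2]
  have h2 : 0 ≤ tu - tu ^ 2 := by nlinarith [hu.1, hu.2]
  have h3 := Real.exp_pos (t₀ * s * Real.log M - E P (worst n Dm ι s) t₀)
  unfold term g₁
  have := le_min h1 h2
  positivity

/-- The minimum is at most `tl`, and `-E₂` is at most of order `n`. Keeping `tl` in the denominator
matters when the saddlepoint is close to `0`. -/
theorem le_term {P : ℝ} (hP : 0 < P) (hDm : Dm < n) {ι s : ℕ} (hι : ι ≤ K) (hs1 : 1 ≤ s)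
    (hs : s ≤ K) {t₀ tl tu : ℝ} (hl : tl ∈ Set.Ioo (0 : ℝ) 1) (hu : tu ∈ Set.Ioo (0 : ℝ) 1) :
    g₁ M P s (worst n Dm ι s) t₀ / (tl * (√2 * (1 + K * P) * √n)) ≤
      term n M Dm P ι s t₀ tl tu := by
  have htl : tl ^ 2 < 1 := by nlinarith [hl.1, hl.2]
  have h1 : 0 < tl - tl ^ 2 := by nlinarith [hl.1, hl.2]
  have h2 : 0 < tu - tu ^ 2 := by nlinarith [hu.1, hu.2]
  have hE := neg_E₂_pos hP (worst n Dm ι s) ⟨⟨Dm, hDm⟩, by simpa [worst] using hs1⟩ htl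
  have hE' := neg_E₂_le hP K (worst n Dm ι s) (worst_le hι hs) htl
  have hg : 0 < g₁ M P s (worst n Dm ι s) t₀ := Real.exp_pos _
  have hsq : √(-E₂ P (worst n Dm ι s) tl) ≤ √2 * (1 + K * P) * √n := by
    refine (Real.sqrt_le_sqrt hE').trans (le_of_eq ?_)
    rw [Real.sqrt_mul (by positivity), Real.sqrt_mul (by positivity), Real.sqrt_sq (by positivity)]
    ring
  have hmin := lt_min h1 h2
  have hsr : (1 : ℝ) ≤ s := by exact_mod_cast hs1
  have hq : 0 < √(-E₂ P (worst n Dm ι s) tl) := Real.sqrt_pos.2 hE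
  unfold term
  refine div_le_div₀ (by positivity) ?_ (by positivity) ?_
  · nlinarith
  · refine mul_le_mul ?_ hsq hq.le hl.1.le
    exact (min_le_left _ _).trans (by nlinarith [hl.1])

/-- All summands are nonnegative and the one of `T` has coefficient at least `1`. The collision term
is kept, since the coding bound pays for collisions separately. -/
theorem le_mainBound (hK : 1 ≤ K) {P P' : ℝ} (t₀ tl tu : ℕ → ℕ → ℝ)
    (hl : ∀ T : Finset (Fin K), T.Nonempty → tl (iota T) T.card ∈ Set.Ioo (0 : ℝ) 1)
    (hu : ∀ T : Finset (Fin K), T.Nonempty → tu (iota T) T.card ∈ Set.Ioo (0 : ℝ) 1)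
    (T : Finset (Fin K)) (hT : T.Nonempty) :
    (K : ℝ) * (K - 1) / (2 * M) + 1 / (K * √(2 * Real.pi)) *
      term n M Dm P (iota T) T.card (t₀ (iota T) T.card) (tl (iota T) T.card)
        (tu (iota T) T.card) ≤ mainBound n M K Dm P P' t₀ tl tu := by
  have h0 : ∀ s ∈ Finset.Icc 1 K, 0 ≤ ((K - 1).choose s : ℝ) *
      term n M Dm P 0 s (t₀ 0 s) (tl 0 s) (tu 0 s) := by
    intro s hs
    rw [Finset.mem_Icc] at hs
    rcases Nat.lt_or_ge s K with h | h
    · obtain ⟨T, hT0, hTs⟩ := exists_iota_zero (K := K) (s := s) h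
      have hT : T.Nonempty := by
        rw [← Finset.card_pos]
        omega
      have h1 := hl T hT
      have h2 := hu T hT
      rw [hT0, hTs] at h1 h2
      exact mul_nonneg (Nat.cast_nonneg _) (term_nonneg P 0 s h1 h2)
    · rw [Nat.choose_eq_zero_of_lt (by omega)]
      simp
  have h1 : ∀ s ∈ Finset.Icc 1 K, 0 ≤ ((K - 1).choose (s - 1) : ℝ) *
      term n M Dm P 1 s (t₀ 1 s) (tl 1 s) (tu 1 s) := by
    intro s hs
    rw [Finset.mem_Icc] at hs
    obtain ⟨T, hT0, hTs⟩ := exists_iota_one (K := K) hs.1 hs.2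
    have hT : T.Nonempty := by
      rw [← Finset.card_pos]
      omega
    have h1 := hl T hT
    have h2 := hu T hT
    rw [hT0, hTs] at h1 h2
    exact mul_nonneg (Nat.cast_nonneg _) (term_nonneg P 1 s h1 h2)
  have hcardT : T.card ∈ Finset.Icc 1 K :=
    Finset.mem_Icc.2 ⟨hT.card_pos, by simpa using Finset.card_le_univ T⟩
  have hterm := term_nonneg (n := n) (M := M) (Dm := Dm) P (iota T) T.card
    (t₀ := t₀ (iota T) T.card) (hl T hT) (hu T hT)
  unfold mainBound
  rw [add_comm]
  refine add_le_add ?_ ?_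
  · refine mul_le_mul_of_nonneg_left ?_ (by positivity)
    refine le_trans ?_ (Finset.single_le_sum
      (f := fun s => ((K - 1).choose s : ℝ) * term n M Dm P 0 s (t₀ 0 s) (tl 0 s) (tu 0 s) +
        ((K - 1).choose (s - 1) : ℝ) * term n M Dm P 1 s (t₀ 1 s) (tl 1 s) (tu 1 s))
      (fun s hs => add_nonneg (h0 s hs) (h1 s hs)) hcardT)
    have hι := iota_le_one T
    interval_cases hi : iota T
    · refine le_add_of_le_of_nonneg (le_mul_of_one_le_left hterm ?_) (h1 _ hcardT)
      exact_mod_cast Nat.choose_pos (card_lt_of_iota_eq_zero hK T hi)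
    · refine le_add_of_nonneg_of_le (h0 _ hcardT) (le_mul_of_one_le_left hterm ?_)
      rw [Finset.mem_Icc] at hcardT
      exact_mod_cast Nat.choose_pos (by omega)
  · unfold p₀
    refine le_add_of_nonneg_right ?_
    positivity

end MainBound

/-! ### Comparison of the coding bound with the explicit bound. -/

theorem eventually_pow_mul_exp_le (A δ : ℝ) (hA : 0 ≤ A) (hδ : 0 < δ) (K : ℕ) :
    ∃ N : ℕ, ∀ n : ℕ, N ≤ n → A * (n + 1) ^ K * √n * Real.exp (-(δ * √n)) ≤ 1 := by
  have h1 := (isLittleO_pow_exp_pos_mul_atTop (2 * K + 1) hδ).bound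
    (show (0 : ℝ) < 1 / (A * 2 ^ K + 1) by positivity)
  have h2 : Filter.Tendsto (fun n : ℕ => √(n : ℝ)) Filter.atTop Filter.atTop :=
    Real.tendsto_sqrt_atTop.comp tendsto_natCast_atTop_atTop
  obtain ⟨N, hN⟩ := Filter.eventually_atTop.1 (h2.eventually h1)
  refine ⟨max N 1, fun n hn => ?_⟩
  have h3 := hN n (le_trans (le_max_left _ _) hn)
  have hn1 : (1 : ℝ) ≤ n := by exact_mod_cast le_trans (le_max_right _ _) hn
  have hs : √(n : ℝ) ^ 2 = n := Real.sq_sqrt (by positivity)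
  have hpow : ((n : ℝ) + 1) ^ K ≤ 2 ^ K * √(n : ℝ) ^ (2 * K) := by
    rw [pow_mul, hs, ← mul_pow]
    gcongr
    linarith
  rw [Real.norm_of_nonneg (by positivity), Real.norm_of_nonneg (by positivity), one_div,
    inv_mul_eq_div, le_div_iff₀ (by positivity)] at h3
  rw [Real.exp_neg, ← div_eq_mul_inv, div_le_one (Real.exp_pos _)]
  refine le_trans ?_ h3
  have h4 : A * (n + 1) ^ K * √n ≤ A * (2 ^ K * √(n : ℝ) ^ (2 * K)) * √n := by gcongr
  have h5 : 0 ≤ √(n : ℝ) ^ (2 * K + 1) := by positivity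
  refine h4.trans ?_
  rw [pow_succ] at h5 ⊢
  nlinarith

/-- With `t₀` below the order `1/√n`, the explicit bound is at least `1`. -/
theorem one_le_mainBound {n M K Dm : ℕ} (hK : 1 ≤ K) (hn : 1 ≤ n) (hDm : Dm < n) {P P' : ℝ}
    (hP : 0 < P) (t₀ tl tu : ℕ → ℕ → ℝ)
    (hl : ∀ T : Finset (Fin K), T.Nonempty → tl (iota T) T.card ∈ Set.Ioo (0 : ℝ) 1)
    (hu : ∀ T : Finset (Fin K), T.Nonempty → tu (iota T) T.card ∈ Set.Ioo (0 : ℝ) 1)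
    (T : Finset (Fin K)) (hT : T.Nonempty)
    (hs : IsSaddle M P T.card (worst n Dm (iota T) T.card) (t₀ (iota T) T.card))
    (hlt : tl (iota T) T.card ≤ t₀ (iota T) T.card) {c : ℝ} (hc1 : c ≤ 1)
    (hc : c ≤ Real.exp (-(K * P)) / (K * √(2 * Real.pi) * (√2 * (1 + K * P))))
    (hsmall : t₀ (iota T) T.card ≤ c / √n) : 1 ≤ mainBound n M K Dm P P' t₀ tl tu := by
  have hKr : (1 : ℝ) ≤ K := by exact_mod_cast hK
  have hnr : (1 : ℝ) ≤ n := by exact_mod_cast hn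
  have hq : 0 < √(n : ℝ) := Real.sqrt_pos.2 (by linarith)
  have hTK : T.card ≤ K := by simpa using Finset.card_le_univ T
  have hmain := le_mainBound (n := n) (M := M) (Dm := Dm) hK (P := P) (P' := P') t₀ tl tu hl hu T hT
  have hterm := le_term (n := n) (M := M) hP hDm ((iota_le_one T).trans hK) hT.card_pos hTK
    (t₀ := t₀ (iota T) T.card) (hl T hT) (hu T hT)
  have hg := exp_le_g₁ hP K M T.card _ (worst_le ((iota_le_one T).trans hK) hTK) hs
  have htl := (hl T hT).1
  have ht0 := hs.1.1
  have hcoll : 0 ≤ (K : ℝ) * (K - 1) / (2 * M) :=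
    div_nonneg (mul_nonneg (by linarith) (by linarith)) (by positivity)
  set t := t₀ (iota T) T.card
  set l := tl (iota T) T.card
  set G := g₁ M P T.card (worst n Dm (iota T) T.card) t
  have h1 : Real.exp (-(K * P)) ≤ G := by
    refine le_trans (Real.exp_le_exp.2 (neg_le_neg ?_)) hg
    have h2 : t ^ 2 ≤ (1 / √n) ^ 2 := by
      refine pow_le_pow_left₀ ht0.le (hsmall.trans ?_) 2
      gcongr
    rw [div_pow, one_pow, Real.sq_sqrt (by linarith), le_div_iff₀ (by linarith)] at h2
    have : 0 ≤ K * P := by positivity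
    nlinarith
  set H := √2 * (1 + K * P)
  have hH : 0 < H := by positivity
  have hR : 0 < √(2 * Real.pi) := by positivity
  -- Here `tl ≤ t₀ ≤ c/√n` bounds the denominator of the summand.
  have h3 : l * (H * √n) ≤ c * H := by
    have : l * √n ≤ c := by
      rw [← le_div_iff₀ hq]
      exact hlt.trans hsmall
    nlinarith
  have h4 : K * √(2 * Real.pi) ≤ G / (l * (H * √n)) := by
    rw [le_div_iff₀ (by positivity)]
    rw [le_div_iff₀ (by positivity)] at hc
    calc K * √(2 * Real.pi) * (l * (H * √n)) ≤ K * √(2 * Real.pi) * (c * H) := by gcongr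
      _ = c * (K * √(2 * Real.pi) * H) := by ring
      _ ≤ _ := hc.trans h1
  have h5 := h4.trans hterm
  have h6 : 1 ≤ 1 / (K * √(2 * Real.pi)) * term n M Dm P (iota T) T.card t l
      (tu (iota T) T.card) := by
    rw [one_div, inv_mul_eq_div, one_le_div (by positivity)]
    exact h5
  linarith

theorem g₁_le_mainBound {n M K Dm : ℕ} (hK : 1 ≤ K) (hn : 1 ≤ n) (hDm : Dm < n) {P P' : ℝ}
    (hP : 0 < P) (t₀ tl tu : ℕ → ℕ → ℝ)
    (hl : ∀ T : Finset (Fin K), T.Nonempty → tl (iota T) T.card ∈ Set.Ioo (0 : ℝ) 1)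
    (hu : ∀ T : Finset (Fin K), T.Nonempty → tu (iota T) T.card ∈ Set.Ioo (0 : ℝ) 1)
    (T : Finset (Fin K)) (hT : T.Nonempty) :
    g₁ M P T.card (worst n Dm (iota T) T.card) (t₀ (iota T) T.card) ≤
      (mainBound n M K Dm P P' t₀ tl tu - K * (K - 1) / (2 * M)) *
        (K * √(2 * Real.pi) * (√2 * (1 + K * P)) * √n) := by
  have hKr : (1 : ℝ) ≤ K := by exact_mod_cast hK
  have hnr : (1 : ℝ) ≤ n := by exact_mod_cast hn
  have hq : 0 < √(n : ℝ) := Real.sqrt_pos.2 (by linarith)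
  have hTK : T.card ≤ K := by simpa using Finset.card_le_univ T
  have hmain := le_mainBound (n := n) (M := M) (Dm := Dm) hK (P := P) (P' := P') t₀ tl tu hl hu T hT
  have hterm := le_term (n := n) (M := M) hP hDm ((iota_le_one T).trans hK) hT.card_pos hTK
    (t₀ := t₀ (iota T) T.card) (hl T hT) (hu T hT)
  obtain ⟨htl, htl1⟩ := hl T hT
  set t := t₀ (iota T) T.card
  set l := tl (iota T) T.card
  have hG : 0 < g₁ M P T.card (worst n Dm (iota T) T.card) t := Real.exp_pos _
  set G := g₁ M P T.card (worst n Dm (iota T) T.card) t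
  set H := √2 * (1 + K * P)
  have hH : 0 < H := by positivity
  have hR : 0 < √(2 * Real.pi) := by positivity
  have h1 : G / (H * √n) ≤ G / (l * (H * √n)) :=
    div_le_div_of_nonneg_left hG.le (by positivity)
      (mul_le_of_le_one_left (by positivity) htl1.le)
  have h2 : 1 / (K * √(2 * Real.pi)) * (G / (H * √n)) ≤
      mainBound n M K Dm P P' t₀ tl tu - K * (K - 1) / (2 * M) := by
    have : 1 / (K * √(2 * Real.pi)) * (G / (H * √n)) ≤ 1 / (K * √(2 * Real.pi)) *
        term n M Dm P (iota T) T.card t l (tu (iota T) T.card) :=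
      mul_le_mul_of_nonneg_left (h1.trans hterm) (by positivity)
    linarith
  calc G = 1 / (K * √(2 * Real.pi)) * (G / (H * √n)) * (K * √(2 * Real.pi) * H * √n) := by
        field_simp
    _ ≤ _ := mul_le_mul_of_nonneg_right h2 (by positivity)

theorem exists_code_of_one_le {n M K Dm : ℕ} (hK : 1 ≤ K) (hKM : K ≤ M) {P P' : ℝ} (hP' : 0 ≤ P')
    {b : ℝ} (hb : 1 ≤ b) :
    ∃ c : Code n M K Dm P P', ∀ D : DelayVector K Dm, c.pupe D ≤ b := by
  obtain ⟨c, -⟩ := exists_code (Dm := Dm) (P := P) hKM (fun _ => (0 : Fin n → ℝ))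
    (P' := P') (fun _ => by
      show ∑ _j : Fin n, (0 : ℝ) ^ 2 ≤ n * P'
      simp only [ne_eq, OfNat.ofNat_ne_zero, not_false_eq_true, zero_pow, Finset.sum_const_zero]
      positivity)
  exact ⟨c, fun D => (pupe_le_one (hK.trans hKM) c D).trans hb⟩

end AUMAC

theorem theorem2 (K : ℕ) (hK : 1 ≤ K) (P P' : ℝ) (hP : 0 < P) (hPP' : P < P')
    (α : ℝ) (hα₀ : 0 ≤ α) (hα₁ : α < 1) :
    ∃ C : ℝ, ∀ (n M Dm : ℕ), 1 ≤ n → K ≤ M → (Dm : ℝ) = α * n →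
      ∀ t₀ tl tu : ℕ → ℕ → ℝ,
      (∀ S : Finset (Fin K), S.Nonempty →
        AUMAC.IsSaddle M P S.card (AUMAC.worst n Dm (AUMAC.iota S) S.card)
            (t₀ (AUMAC.iota S) S.card) ∧
        AUMAC.IsLower M P S.card (AUMAC.worst n Dm (AUMAC.iota S) S.card)
            (tl (AUMAC.iota S) S.card) ∧
        AUMAC.IsUpper M P S.card (AUMAC.worst n Dm (AUMAC.iota S) S.card)
            (tu (AUMAC.iota S) S.card)) →
      (∀ S : Finset (Fin K), S.Nonempty → ∀ D : AUMAC.DelayVector K Dm, ∀ t : ℝ,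
        AUMAC.IsSaddle M P S.card (AUMAC.overlap n S D) t →
          tl (AUMAC.iota S) S.card ≤ t ∧ t ≤ tu (AUMAC.iota S) S.card) →
      ∃ c : AUMAC.Code n M K Dm P P', ∀ D : AUMAC.DelayVector K Dm,
        c.pupe D ≤ AUMAC.mainBound n M K Dm P P' t₀ tl tu
          + C * (Real.exp (-(n : ℝ)) / Real.sqrt n) := by
  have hKr : (1 : ℝ) ≤ K := by exact_mod_cast hK
  have hP' : 0 < P' := hP.trans hPP'
  -- Any power strictly between `P` and `P'` would do.
  obtain ⟨Q, hQ⟩ : ∃ Q : NNReal, (Q : ℝ) = (P + P') / 2 :=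
    ⟨⟨(P + P') / 2, by linarith⟩, rfl⟩
  have hPQ : P < Q := by rw [hQ]; linarith
  have hQP' : (Q : ℝ) < P' := by rw [hQ]; linarith
  set H := K * √(2 * Real.pi) * (√2 * (1 + K * P)) with hHdef
  have hH : 0 < H := by positivity
  -- The threshold for `t₀ √n`: at or below it the explicit bound reaches `1`, above it the power
  -- gain is at most `exp(-δ√n)`.
  set c₀ := min 1 (Real.exp (-(K * P)) / H)
  have hc₀ : 0 < c₀ := lt_min one_pos (by positivity)
  have hgain := AUMAC.powerGain_pos hP hPQ
  set δ := AUMAC.powerGain P Q * c₀ * (1 - α)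
  have hδ : 0 < δ := mul_pos (mul_pos hgain hc₀) (by linarith)
  set B : ℝ := Fintype.card (Finset (Fin K) × (Fin K → Fin K)) * (1 - Q / P')⁻¹ ^ (2 * K) with hB
  have hB0 : 0 ≤ B := by
    have : 0 ≤ 1 - Q / P' := by rw [sub_nonneg, div_le_one hP']; exact hQP'.le
    positivity
  obtain ⟨N, hN⟩ := AUMAC.eventually_pow_mul_exp_le (B * H) δ (by positivity) hδ K
  -- With this constant the remainder is at least `1` for all `n < N`; for `n ≥ N` only its sign is
  -- used.
  refine ⟨Real.exp N * √N, fun n M Dm hn hKM hDmα t₀ tl tu hpts hsad => ?_⟩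
  have hnr : (1 : ℝ) ≤ n := by exact_mod_cast hn
  have hq : 0 < √(n : ℝ) := Real.sqrt_pos.2 (by linarith)
  have hDm : Dm < n := by
    have : (Dm : ℝ) < n := by rw [hDmα]; nlinarith
    exact_mod_cast this
  have hl : ∀ T : Finset (Fin K), T.Nonempty → tl (AUMAC.iota T) T.card ∈ Set.Ioo (0 : ℝ) 1 :=
    fun T hT => (hpts T hT).2.1.1
  have hu : ∀ T : Finset (Fin K), T.Nonempty → tu (AUMAC.iota T) T.card ∈ Set.Ioo (0 : ℝ) 1 :=
    fun T hT => (hpts T hT).2.2.1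
  have hlt : ∀ T : Finset (Fin K), T.Nonempty → tl (AUMAC.iota T) T.card ≤ t₀ (AUMAC.iota T) T.card :=
    fun T hT => (hsad T hT (AUMAC.worstDelay K Dm) _
      ((AUMAC.overlap_worstDelay (n := n) (Dm := Dm) T).symm ▸ (hpts T hT).1)).1
  have hT₀ : ({⟨0, hK⟩} : Finset (Fin K)).Nonempty := Finset.singleton_nonempty _
  have hΛ : (K : ℝ) * (K - 1) / (2 * M) ≤ AUMAC.mainBound n M K Dm P P' t₀ tl tu := by
    refine le_trans (le_add_of_nonneg_right ?_) (AUMAC.le_mainBound hK t₀ tl tu hl hu _ hT₀)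
    exact mul_nonneg (by positivity) (AUMAC.term_nonneg P _ _ (hl _ hT₀) (hu _ hT₀))
  have hcoll : 0 ≤ (K : ℝ) * (K - 1) / (2 * M) :=
    div_nonneg (mul_nonneg (by linarith) (by linarith)) (by positivity)
  rcases Nat.lt_or_ge n N with hnN | hnN
  · refine AUMAC.exists_code_of_one_le hK hKM hP'.le ?_
    have hNr : (n : ℝ) ≤ N := by exact_mod_cast hnN.le
    have h1 : 1 ≤ Real.exp N * √N * (Real.exp (-(n : ℝ)) / √n) := by
      rw [Real.exp_neg, ← one_div, div_div, mul_one_div, one_le_div (by positivity)]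
      gcongr
    linarith
  have hC : 0 ≤ Real.exp N * √N * (Real.exp (-(n : ℝ)) / √n) := by positivity
  by_cases hsmall : ∃ T : Finset (Fin K), T.Nonempty ∧ t₀ (AUMAC.iota T) T.card ≤ c₀ / √n
  · obtain ⟨T, hT, ht⟩ := hsmall
    refine AUMAC.exists_code_of_one_le hK hKM hP'.le ?_
    have := AUMAC.one_le_mainBound hK hn hDm hP (P' := P') t₀ tl tu hl hu T hT (hpts T hT).1 (hlt T hT)
      (min_le_left _ _) (min_le_right _ _) ht
    linarith
  push Not at hsmall
  -- `Λ` is the room left for decoding losses once collisions are paid for.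
  set Λ := AUMAC.mainBound n M K Dm P P' t₀ tl tu - K * (K - 1) / (2 * M) with hΛdef
  have hΛ0 : 0 ≤ Λ := sub_nonneg.2 hΛ
  obtain ⟨x, hx, hloss⟩ := AUMAC.exists_codebook hn (hK.trans hKM) hDm.le hP Q hPQ.le hQP' t₀
    (fun T hT => (hpts T hT).1.1) (Λ * (H * √n) * Real.exp (-(δ * √n))) (fun T hT => by
      refine mul_le_mul (AUMAC.g₁_le_mainBound hK hn hDm hP t₀ tl tu hl hu T hT) ?_
        (Real.exp_pos _).le (by positivity)
      rw [Real.exp_le_exp, neg_le_neg_iff]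
      have h1 := (hsmall T hT).le
      have h2 : (n : ℝ) - Dm = (1 - α) * n := by rw [hDmα]; ring
      rw [h2]
      have h3 : c₀ / √n * n = c₀ * √n := by
        rw [div_mul_eq_mul_div, div_eq_iff hq.ne', mul_assoc, Real.mul_self_sqrt (by linarith)]
      calc δ * √n = AUMAC.powerGain P Q * (1 - α) * (c₀ / √n * n) := by rw [h3]; ring
        _ ≤ AUMAC.powerGain P Q * (1 - α) * (t₀ (AUMAC.iota T) T.card * n) := by
          have : 0 ≤ AUMAC.powerGain P Q * (1 - α) := mul_nonneg hgain.le (by linarith)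
          gcongr
        _ = _ := by ring)
  obtain ⟨code, rfl⟩ := AUMAC.exists_code (Dm := Dm) (P := P) hKM x hx
  refine ⟨code, fun D => ?_⟩
  have hb := hN n hnN
  have hfin : ((n : ℝ) + 1) ^ K * (Fintype.card (Finset (Fin K) × (Fin K → Fin K)) *
      ((1 - Q / P')⁻¹ ^ (2 * K) * (Λ * (H * √n) * Real.exp (-(δ * √n))))) ≤ Λ := by
    calc _ = Λ * (B * H * (n + 1) ^ K * √n * Real.exp (-(δ * √n))) := by rw [hB]; ring
      _ ≤ Λ * 1 := mul_le_mul_of_nonneg_left hb hΛ0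
      _ = Λ := mul_one _
  have := AUMAC.pupe_le hP (hK.trans hKM) code D hΛ0
    ((hloss D).trans (ENNReal.ofReal_le_ofReal hfin))
  linarith
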